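/- Let $d\ge 1$, let $\Omega\subset\mathbb{R}^d$ be a bounded open set, and let $a$ be a measurable field of symmetric $d\times d$ matrices on $\Omega$ such that, for almost every $x\in\Omega$ and all $l\in\mathbb{R}^d$, $\lambda_{\min}(a)|l|^2\le l^T a(x)\,l\le\lambda_{\max}(a)|l|^2$, with $\lambda_{\min}(a)>0$. On $H^1_0(\Omega)$ (the closure of $C_c^\infty(\Omega)$ in $H^1(\Omega)$) put $\langle v,w\rangle_a=\int_\Omega(\nabla v)^Ta\nabla w$ and $\|v\|_a=\langle v,v\rangle_a^{1/2}$. For $g\in L^2(\Omega)$ the problem $-\operatorname{div}(a\nabla u)=g$ in $\Omega$, $u=0$ on $\partial\Omega$, has a unique weak solution $u\in H^1_0(\Omega)$, meaning $\langle v,u\rangle_a=\int_\Omega gv$ for all $v\in H^1_0(\Omega)$; write $u=\mathcal{L}^{-1}g$. Call a finite family $(\tau_i)_{i}$ of convex subsets of $\Omega$ of positive volume a convex partition of $\Omega$ of mesh at most $H$ if the $\tau_i$ are pairwise disjoint and cover $\Omega$, both up to sets of measure zero, and each $\tau_i$ has diameter at most $H$. Let $\phi_i$ be the indicator function of $\tau_i$.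 The gamblet $\psi_i$ is a minimizer of $\|\psi\|_a$ over all $\psi\in H^1_0(\Omega)$ with $\int_\Omega\phi_j\psi=\delta_{i,j}$ for all $j$. **One level.** Let $(\tau_i)_i$ be a convex partition of $\Omega$ of mesh at most $H$. Then the gamblets $\psi_i$ exist and are unique, and for every $g\in L^2(\Omega)$, with $u=\mathcal{L}^{-1}g$, $$\inf_{v\in\operatorname{span}\{\psi_i\}}\|u-v\|_a\le\frac{2}{\pi\sqrt{\lambda_{\min}(a)}}\,H\,\|g\|_{L^2(\Omega)},$$ and the infimum is attained at $v=u^*:=\sum_i\psi_i\int_\Omega u\,\phi_i\in\operatorname{span}\{\psi_i\}$. **Several levels.** Let $\mathcal{I}$ be a finite set of $q$-tuples of positive integers and, for $1\le k\le q$, let $\mathcal{I}^{(k)}$ be the set of truncations $(i_1,\dots,i_k)$ of its elements. For $1\le k\le q$ let $(\tau_i^{(k)})_{i\in\mathcal{I}^{(k)}}$ be a convex partition of $\Omega$ of mesh at most $H_k$, and suppose that for $1\le k<q$ and $i\in\mathcal{I}^{(k)}$ the set $\tau_i^{(k)}$ is, up to a set of measure zero, the union of the $\tau_j^{(k+1)}$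 over those $j\in\mathcal{I}^{(k+1)}$ whose truncation to length $k$ is $i$. Let $\phi_i^{(k)}$ be the indicator function of $\tau_i^{(k)}$, let $\psi_i^{(k)}$, $i\in\mathcal{I}^{(k)}$, be the corresponding gamblets, and put $\mathfrak{V}^{(k)}=\operatorname{span}\{\psi_i^{(k)}: i\in\mathcal{I}^{(k)}\}$ for $1\le k\le q$ and $\mathfrak{V}^{(q+1)}=H^1_0(\Omega)$. Then for every $k\in\{1,\dots,q\}$: 1. $\mathfrak{V}^{(k)}\subset\mathfrak{V}^{(k+1)}$ and $\mathfrak{V}^{(k)}=\operatorname{span}\{\mathcal{L}^{-1}\phi_i^{(k)}: i\in\mathcal{I}^{(k)}\}$; 2. for every $g\in L^2(\Omega)$, with $u=\mathcal{L}^{-1}g$ and $u^{(k)}:=\sum_{i\in\mathcal{I}^{(k)}}\psi_i^{(k)}\int_\Omega u\,\phi_i^{(k)}\in\mathfrak{V}^{(k)}$, $$\|u-u^{(k)}\|_a=\inf_{v\in\mathfrak{V}^{(k)}}\|u-v\|_a\le\frac{2}{\pi\sqrt{\lambda_{\min}(a)}}\,H_k\,\|g\|_{L^2(\Omega)}.$$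 -/

import Mathlib

open MeasureTheory
open scoped ContDiff Matrix

noncomputable section

namespace Gamblet

/-- The Hilbert space `L²(Ω)` of real functions on `Ω ⊆ ℝ^d`. -/
abbrev L2 {d : ℕ} (Ω : Set (EuclideanSpace ℝ (Fin d))) : Type :=
  Lp ℝ 2 (volume.restrict Ω)

/-- The Hilbert space `L²(Ω; ℝ^d)` of vector fields on `Ω ⊆ ℝ^d`. -/
abbrev L2Vec {d : ℕ} (Ω : Set (EuclideanSpace ℝ (Fin d))) : Type :=
  Lp (EuclideanSpace ℝ (Fin d)) 2 (volume.restrict Ω)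

/-- Pairs `(u, G)` with `u ∈ L²(Ω)`, `G ∈ L²(Ω; ℝ^d)`, with the Hilbert norm
`(‖u‖² + ‖G‖²)^(1/2)`. On pairs `(u, ∇u)` this is the `H¹(Ω)` norm of `u`. -/
abbrev L2Pair {d : ℕ} (Ω : Set (EuclideanSpace ℝ (Fin d))) : Type :=
  WithLp 2 (L2 Ω × L2Vec Ω)

/-- The subspace of the pairs `(η, ∇η)` with `η ∈ C_c^∞(Ω)`. -/
def testPairs {d : ℕ} (Ω : Set (EuclideanSpace ℝ (Fin d))) : Submodule ℝ (L2Pair Ω) where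
  carrier := {p | ∃ η : EuclideanSpace ℝ (Fin d) → ℝ,
    ContDiff ℝ ∞ η ∧ HasCompactSupport η ∧ tsupport η ⊆ Ω ∧
    p.fst =ᵐ[volume.restrict Ω] η ∧ p.snd =ᵐ[volume.restrict Ω] gradient η}
  zero_mem' := by
    refine ⟨0, contDiff_const, HasCompactSupport.zero, by simp, ?_, ?_⟩
    · exact Lp.coeFn_zero _ _ _
    · have h : gradient (0 : EuclideanSpace ℝ (Fin d) → ℝ) = 0 := by
        funext x
        exact gradient_fun_const x (0 : ℝ)
      rw [h]
      exact Lp.coeFn_zero _ _ _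
  add_mem' := by
    rintro p p' ⟨η, h1, h2, h3, h4, h5⟩ ⟨η', h1', h2', h3', h4', h5'⟩
    refine ⟨η + η', h1.add h1', h2.add h2', ?_, ?_, ?_⟩
    · exact (tsupport_add η η').trans (Set.union_subset h3 h3')
    · filter_upwards [Lp.coeFn_add p.fst p'.fst, h4, h4'] with x hx hy hz
      rw [WithLp.add_fst, hx, Pi.add_apply, hy, hz, Pi.add_apply]
    · filter_upwards [Lp.coeFn_add p.snd p'.snd, h5, h5'] with x hx hy hz
      have hd : DifferentiableAt ℝ η x := (h1.differentiable (by simp)) x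
      have hd' : DifferentiableAt ℝ η' x := (h1'.differentiable (by simp)) x
      rw [WithLp.add_snd, hx, Pi.add_apply, hy, hz]
      simp only [gradient]
      rw [fderiv_add hd hd', map_add]
  smul_mem' := by
    rintro c p ⟨η, h1, h2, h3, h4, h5⟩
    refine ⟨c • η, contDiff_const.smul h1, h2.smul_left (f := fun _ => c), ?_, ?_, ?_⟩
    · exact (closure_mono (Function.support_const_smul_subset c η)).trans h3
    · filter_upwards [Lp.coeFn_smul c p.fst, h4] with x hx hy
      simp [hx, hy]
    · filter_upwards [Lp.coeFn_smul c p.snd, h5] with x hx hy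
      have hd : DifferentiableAt ℝ η x := (h1.differentiable (by simp)) x
      rw [WithLp.smul_snd, hx, Pi.smul_apply, hy]
      simp only [gradient]
      rw [fderiv_const_smul hd, map_smul]

/-- The Sobolev space `H¹₀(Ω)`, the closure of `C_c^∞(Ω)` in the `H¹(Ω)` norm. A function
`u ∈ H¹₀(Ω)` is recorded together with its weak gradient, as the pair `(u, ∇u)`; the second
component is determined by the first. -/
def H10 {d : ℕ} (Ω : Set (EuclideanSpace ℝ (Fin d))) : Submodule ℝ (L2Pair Ω) :=
  (testPairs Ω).topologicalClosure

/-- The function underlying an element of `H¹₀(Ω)`. -/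
def val {d : ℕ} {Ω : Set (EuclideanSpace ℝ (Fin d))} (u : H10 Ω) : L2 Ω :=
  (u : L2Pair Ω).fst

/-- The weak gradient of an element of `H¹₀(Ω)`. -/
def grad {d : ℕ} {Ω : Set (EuclideanSpace ℝ (Fin d))} (u : H10 Ω) : L2Vec Ω :=
  (u : L2Pair Ω).snd

/-- `a` is a measurable field of symmetric matrices on `Ω`, uniformly elliptic and bounded:
`lmin |l|² ≤ lᵀ a(x) l ≤ lmax |l|²` for almost every `x ∈ Ω` and all `l`, with `lmin > 0`. -/
structure IsElliptic {d : ℕ} (Ω : Set (EuclideanSpace ℝ (Fin d)))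
    (a : EuclideanSpace ℝ (Fin d) → Matrix (Fin d) (Fin d) ℝ) (lmin lmax : ℝ) : Prop where
  pos : 0 < lmin
  measurable : ∀ i j, AEStronglyMeasurable (fun x => a x i j) (volume.restrict Ω)
  symm : ∀ᵐ x ∂(volume.restrict Ω), (a x).IsSymm
  lower : ∀ᵐ x ∂(volume.restrict Ω), ∀ l : Fin d → ℝ,
    lmin * (l ⬝ᵥ l) ≤ l ⬝ᵥ (a x *ᵥ l)
  upper : ∀ᵐ x ∂(volume.restrict Ω), ∀ l : Fin d → ℝ,
    l ⬝ᵥ (a x *ᵥ l) ≤ lmax * (l ⬝ᵥ l)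

/-- The energy scalar product `⟨v, w⟩_a = ∫_Ω (∇v)ᵀ a ∇w`. -/
def energyInner {d : ℕ} {Ω : Set (EuclideanSpace ℝ (Fin d))}
    (a : EuclideanSpace ℝ (Fin d) → Matrix (Fin d) (Fin d) ℝ) (v w : H10 Ω) : ℝ :=
  ∫ x in Ω, (grad v x).ofLp ⬝ᵥ (a x *ᵥ (grad w x).ofLp)

/-- The energy norm `‖v‖_a = (∫_Ω (∇v)ᵀ a ∇v)^(1/2)`. -/
def energyNorm {d : ℕ} {Ω : Set (EuclideanSpace ℝ (Fin d))}
    (a : EuclideanSpace ℝ (Fin d) → Matrix (Fin d) (Fin d) ℝ) (v : H10 Ω) : ℝ :=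
  Real.sqrt (energyInner a v v)

/-- `u ∈ H¹₀(Ω)` is the weak solution of `-div(a ∇u) = g` in `Ω`, `u = 0` on `∂Ω`,
that is, `u = 𝓛⁻¹ g` for `𝓛 = -div(a ∇·)`. -/
def IsWeakSolution {d : ℕ} {Ω : Set (EuclideanSpace ℝ (Fin d))}
    (a : EuclideanSpace ℝ (Fin d) → Matrix (Fin d) (Fin d) ℝ)
    (g : EuclideanSpace ℝ (Fin d) → ℝ) (u : H10 Ω) : Prop :=
  ∀ v : H10 Ω, energyInner a v u = ∫ x in Ω, g x * val v x

/-- The measurement `∫_Ω ψ φ` of `ψ ∈ H¹₀(Ω)` by `φ`. -/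
def measurement {d : ℕ} {Ω : Set (EuclideanSpace ℝ (Fin d))}
    (φ : EuclideanSpace ℝ (Fin d) → ℝ) (ψ : H10 Ω) : ℝ :=
  ∫ x in Ω, φ x * val ψ x

open Classical in
/-- The constraints `∫_Ω φ_j ψ = δ_{i,j}` for all `j`. -/
def IsAdmissible {d : ℕ} {Ω : Set (EuclideanSpace ℝ (Fin d))} {ι : Type}
    (φ : ι → EuclideanSpace ℝ (Fin d) → ℝ) (i : ι) (ψ : H10 Ω) : Prop :=
  ∀ j, measurement (φ j) ψ = if i = j then 1 else 0

/-- `(ψ_i)` are the gamblets of the measurement functions `(φ_i)`: for each `i`, `ψ_i` minimizes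
`‖ψ‖_a` over all `ψ ∈ H¹₀(Ω)` with `∫_Ω φ_j ψ = δ_{i,j}` for all `j`. -/
def IsGamblets {d : ℕ} {Ω : Set (EuclideanSpace ℝ (Fin d))} {ι : Type}
    (a : EuclideanSpace ℝ (Fin d) → Matrix (Fin d) (Fin d) ℝ)
    (φ : ι → EuclideanSpace ℝ (Fin d) → ℝ) (ψ : ι → H10 Ω) : Prop :=
  ∀ i, IsAdmissible φ i (ψ i) ∧
    ∀ η : H10 Ω, IsAdmissible φ i η → energyNorm a (ψ i) ≤ energyNorm a η

/-- `∑_i ψ_i ∫_Ω u φ_i`. -/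
def recovery {d : ℕ} {Ω : Set (EuclideanSpace ℝ (Fin d))} {ι : Type} [Fintype ι]
    (φ : ι → EuclideanSpace ℝ (Fin d) → ℝ) (ψ : ι → H10 Ω) (u : H10 Ω) : H10 Ω :=
  ∑ i, measurement (φ i) u • ψ i

/-- The span of the functions `𝓛⁻¹ φ_i`. -/
def solutionSpan {d : ℕ} (Ω : Set (EuclideanSpace ℝ (Fin d))) {ι : Type}
    (a : EuclideanSpace ℝ (Fin d) → Matrix (Fin d) (Fin d) ℝ)
    (φ : ι → EuclideanSpace ℝ (Fin d) → ℝ) : Submodule ℝ (H10 Ω) :=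
  Submodule.span ℝ {w | ∃ i, IsWeakSolution a (φ i) w}

/-- The indicator functions of the sets `τ_i`. -/
def cellIndicator {d : ℕ} {ι : Type} (τ : ι → Set (EuclideanSpace ℝ (Fin d))) (i : ι) :
    EuclideanSpace ℝ (Fin d) → ℝ :=
  (τ i).indicator fun _ => 1

/-- `(τ_i)` is a partition of `Ω`, up to sets of measure zero, into convex subsets of `Ω` of
positive volume and of diameter at most `H`. -/
structure IsConvexPartition {d : ℕ} {ι : Type} (Ω : Set (EuclideanSpace ℝ (Fin d)))
    (τ : ι → Set (EuclideanSpace ℝ (Fin d))) (H : ℝ) : Prop where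
  subset : ∀ i, τ i ⊆ Ω
  disjoint : ∀ i j, i ≠ j → volume (τ i ∩ τ j) = 0
  cover : volume (Ω \ ⋃ i, τ i) = 0
  convex : ∀ i, Convex ℝ (τ i)
  volume_pos : ∀ i, 0 < volume (τ i)
  diam_le : ∀ i, Metric.diam (τ i) ≤ H

/-- An index tree of depth `q`: a finite set of `q`-tuples of positive integers, a tuple being
a list of length `q`. -/
def IsIndexTree (q : ℕ) (I : Finset (List ℕ)) : Prop :=
  ∀ i ∈ I, i.length = q ∧ ∀ n ∈ i, 1 ≤ n

/-- The set `I^(k)` of the truncations `i^(k) = (i_1, …, i_k)` of the elements of `I`. -/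
def level (I : Finset (List ℕ)) (k : ℕ) : Finset (List ℕ) :=
  I.image (List.take k)

/-- The set of the `j ∈ I^(k+1)` with `j^(k) = i`. -/
def children (I : Finset (List ℕ)) (k : ℕ) (i : List ℕ) : Finset (List ℕ) :=
  (level I (k + 1)).filter fun j => j.take k = i

/-- A hierarchy of nested partitions of `Ω`: for `1 ≤ k ≤ q` the sets `τ_i^(k)`, `i ∈ I^(k)`, are
a convex partition of mesh at most `H_k`, and for `k < q` each `τ_i^(k)` is, up to a set of
measure zero, the union of the `τ_j^(k+1)` over the children `j` of `i`. -/
structure IsNestedPartition {d : ℕ} (Ω : Set (EuclideanSpace ℝ (Fin d))) (q : ℕ)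
    (I : Finset (List ℕ)) (τ : (k : ℕ) → level I k → Set (EuclideanSpace ℝ (Fin d)))
    (H : ℕ → ℝ) : Prop where
  tree : IsIndexTree q I
  partition : ∀ k, 1 ≤ k → k ≤ q → IsConvexPartition Ω (τ k) (H k)
  nested : ∀ k, 1 ≤ k → k < q → ∀ i : level I k,
    τ k i =ᵐ[volume] ⋃ j : level I (k + 1), ⋃ _ : j.val ∈ children I k i, τ (k + 1) j

/-- The spaces `V^(k) = span {ψ_i^(k) : i ∈ I^(k)}` for `k ≤ q`, and `V^(q+1) = H¹₀(Ω)`. -/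
def gambletSpace {d : ℕ} {Ω : Set (EuclideanSpace ℝ (Fin d))} (q : ℕ) {I : Finset (List ℕ)}
    (ψ : (k : ℕ) → level I k → H10 Ω) (k : ℕ) : Submodule ℝ (H10 Ω) :=
  if k ≤ q then Submodule.span ℝ (Set.range (ψ k)) else ⊤

end Gamblet

end

/-!
The energy estimate reduces to the sharp Poincaré inequality on convex cells. The functions
`𝓛⁻¹ φ_i` satisfy `⟨v, 𝓛⁻¹ φ_i⟩_a = ∫ φ_i v`, so a function with vanishing measurements is
`a`-orthogonal to their span. Hence the gamblets are the basis of this span dual to the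
measurements, and `u - u*`, all of whose measurements vanish, is the error of the `a`-orthogonal
projection of `u`. Galerkin orthogonality then gives
`‖u - u*‖_a² = ∫ g (u - u*) ≤ ‖g‖ ‖u - u*‖`, and `u - u*` has mean zero on every cell. Nestedness
holds because `φ_i^(k)` is the sum of the `φ_j^(k+1)` over the children `j` of `i`.

The Poincaré inequality, with twice the Payne–Weinberger constant, is proved by needle
decomposition. If it failed for a function of mean zero, the cell could be bisected repeatedly into
convex pieces on which the mean stays zero and the inequality still fails, until the pieces are
close to a segment. There the inequality is one-dimensional, for the measure whose density is the
volume of the cross-section. This density is quasiconcave by the Prékopa–Leindler inequality, so the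
interval splits at its mode into two on which it is monotone, and each of them inherits Wirtinger's
inequality from the uniform measures on the subintervals with an endpoint at the mode.
-/

noncomputable section

namespace Gamblet

open Set Filter Topology
open scoped ENNReal Pointwise

/-! ### The Brunn–Minkowski and Prékopa–Leindler inequalities -/

theorem volume_add_volume_le_of_isCompact {A B C : Set ℝ} (hA : IsCompact A) (hB : IsCompact B)
    (hA₀ : A.Nonempty) (hB₀ : B.Nonempty) (hC : ∀ x ∈ A, ∀ y ∈ B, x + y ∈ C) :
    volume A + volume B ≤ volume C := by
  obtain ⟨α, hαA, hα⟩ := hA.exists_isGreatest hA₀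
  obtain ⟨β, hβB, hβ⟩ := hB.exists_isLeast hB₀
  -- `A + β` and `α + B` lie in `C` and meet only in `α + β`
  have hdisj : AEDisjoint volume ((fun x => x + β) '' A) ((fun y => α + y) '' B) := by
    refine measure_mono_null (t := {α + β}) ?_ (by simp)
    rintro _ ⟨⟨x, hx, rfl⟩, y, hy, hxy⟩
    have hxα := hα hx
    have hβy := hβ hy
    simp only at hxy
    simp only [mem_singleton_iff]
    linarith
  have hmeas : MeasurableSet ((fun y => α + y) '' B) := (hB.image (by fun_prop)).measurableSet
  calc volume A + volume B
      = volume ((fun x => x + β) '' A) + volume ((fun y => α + y) '' B) := by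
        rw [image_add_right, measure_preimage_add_right, image_add_left, measure_preimage_add]
    _ = volume ((fun x => x + β) '' A ∪ (fun y => α + y) '' B) :=
        (measure_union₀ hmeas.nullMeasurableSet hdisj).symm
    _ ≤ volume C := measure_mono <| union_subset
        (image_subset_iff.2 fun x hx => hC x hx β hβB)
        (image_subset_iff.2 fun y hy => hC α hαA y hy)

theorem volume_add_volume_le {A B C : Set ℝ} (hA : MeasurableSet A) (hB : MeasurableSet B)
    (hA₀ : A.Nonempty) (hB₀ : B.Nonempty) (hC : ∀ x ∈ A, ∀ y ∈ B, x + y ∈ C) :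
    volume A + volume B ≤ volume C := by
  obtain ⟨x₀, hx₀⟩ := hA₀
  obtain ⟨y₀, hy₀⟩ := hB₀
  rw [hA.measure_eq_iSup_isCompact, hB.measure_eq_iSup_isCompact]
  simp only [iSup_and']
  refine ENNReal.biSup_add_biSup_le' ⟨∅, by simp⟩ ⟨∅, by simp⟩ ?_
  rintro K ⟨hKA, hK⟩ L ⟨hLB, hL⟩
  calc volume K + volume L ≤ volume (insert x₀ K) + volume (insert y₀ L) := by
        gcongr <;> exact subset_insert _ _
    _ ≤ volume C := volume_add_volume_le_of_isCompact (hK.insert x₀) (hL.insert y₀)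
        (insert_nonempty _ _) (insert_nonempty _ _) fun x hx y hy =>
          hC x (insert_subset hx₀ hKA hx) y (insert_subset hy₀ hLB hy)

theorem ofReal_mul_volume_add_le {a b : ℝ} (ha : 0 < a) (hb : 0 < b) {A B C : Set ℝ}
    (hA : MeasurableSet A) (hB : MeasurableSet B) (hA₀ : A.Nonempty) (hB₀ : B.Nonempty)
    (hC : ∀ x ∈ A, ∀ y ∈ B, a * x + b * y ∈ C) :
    ENNReal.ofReal a * volume A + ENNReal.ofReal b * volume B ≤ volume C := by
  have h := volume_add_volume_le (C := C) (hA.const_smul₀ a) (hB.const_smul₀ b) hA₀.smul_set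
    hB₀.smul_set (by
      rintro _ ⟨x, hx, rfl⟩ _ ⟨y, hy, rfl⟩
      exact hC x hx y hy)
  simpa [Measure.addHaar_smul, abs_of_pos ha, abs_of_pos hb] using h

theorem volume_restrict_Ioi_ofReal_lt (p : ℝ≥0∞) :
    volume.restrict (Ioi (0 : ℝ)) {s | ENNReal.ofReal s < p} = p := by
  rw [Measure.restrict_apply (measurableSet_lt ENNReal.measurable_ofReal measurable_const)]
  rcases eq_or_ne p ⊤ with rfl | hp
  · simp
  · have : {s : ℝ | ENNReal.ofReal s < p} ∩ Ioi 0 = Ioo 0 p.toReal := by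
      ext s
      simp only [mem_inter_iff, mem_ofPred_eq, mem_Ioi, mem_Ioo, and_comm (a := 0 < s)]
      exact and_congr_left fun hs => ENNReal.ofReal_lt_iff_lt_toReal hs.le hp
    rw [this, Real.volume_Ioo, sub_zero, ENNReal.ofReal_toReal hp]

theorem lintegral_eq_lintegral_measure_ofReal_lt {α : Type*} [MeasurableSpace α] (μ : Measure α)
    [SFinite μ] {f : α → ℝ≥0∞} (hf : Measurable f) :
    ∫⁻ x, f x ∂μ = ∫⁻ s in Ioi (0 : ℝ), μ {x | ENNReal.ofReal s < f x} := by
  have hmeas : MeasurableSet {z : α × ℝ | ENNReal.ofReal z.2 < f z.1} :=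
    measurableSet_lt (by fun_prop) (by fun_prop)
  calc ∫⁻ x, f x ∂μ
      = ∫⁻ x, volume.restrict (Ioi (0 : ℝ)) (Prod.mk x ⁻¹' {z | ENNReal.ofReal z.2 < f z.1}) ∂μ :=
        lintegral_congr fun x => (volume_restrict_Ioi_ofReal_lt (f x)).symm
    _ = ∫⁻ s in Ioi (0 : ℝ), μ {x | ENNReal.ofReal s < f x} := by
        rw [← Measure.prod_apply hmeas, Measure.prod_apply_symm hmeas]
        rfl

theorem ofReal_mul_lintegral_add_le {a b : ℝ} (ha : 0 < a) (hb : 0 < b) {f g h : ℝ → ℝ≥0∞}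
    (hf : Measurable f) (hg : Measurable g) (hh : Measurable h) (hsup : ⨆ x, f x = ⨆ x, g x)
    (hfgh : ∀ x y, min (f x) (g y) ≤ h (a * x + b * y)) :
    ENNReal.ofReal a * (∫⁻ x, f x) + ENNReal.ofReal b * (∫⁻ x, g x) ≤ ∫⁻ x, h x := by
  have hmeas (f : ℝ → ℝ≥0∞) : Measurable fun s => volume {x | ENNReal.ofReal s < f x} :=
    Antitone.measurable fun s t hst => measure_mono fun x hx =>
      (ENNReal.ofReal_le_ofReal hst).trans_lt hx
  rw [lintegral_eq_lintegral_measure_ofReal_lt volume hf,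
    lintegral_eq_lintegral_measure_ofReal_lt volume hg,
    lintegral_eq_lintegral_measure_ofReal_lt volume hh, ← lintegral_const_mul _ (hmeas f),
    ← lintegral_const_mul _ (hmeas g), ← lintegral_add_left ((hmeas f).const_mul _)]
  refine lintegral_mono fun s => ?_
  by_cases hs : ENNReal.ofReal s < ⨆ x, f x
  · have hs' : ENNReal.ofReal s < ⨆ x, g x := hsup ▸ hs
    exact ofReal_mul_volume_add_le ha hb (measurableSet_lt measurable_const hf)
      (measurableSet_lt measurable_const hg) (lt_iSup_iff.1 hs) (lt_iSup_iff.1 hs')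
      fun x hx y hy => (lt_min hx hy).trans_le (hfgh x y)
  · have hf₀ : {x | ENNReal.ofReal s < f x} = ∅ :=
      eq_empty_of_forall_notMem fun x hx => hs (lt_iSup_iff.2 ⟨x, hx⟩)
    have hg₀ : {x | ENNReal.ofReal s < g x} = ∅ :=
      eq_empty_of_forall_notMem fun x hx => hs (hsup ▸ lt_iSup_iff.2 ⟨x, hx⟩)
    simp [hf₀, hg₀]

theorem ennreal_geom_mean_le {a b : ℝ} (ha : 0 < a) (hb : 0 < b) (hab : a + b = 1) (p q : ℝ≥0∞) :
    p ^ a * q ^ b ≤ ENNReal.ofReal a * p + ENNReal.ofReal b * q := by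
  rcases eq_or_ne p ⊤ with rfl | hp
  · simp [ENNReal.mul_top, ha]
  rcases eq_or_ne q ⊤ with rfl | hq
  · simp [ENNReal.mul_top, hb]
  lift p to NNReal using hp
  lift q to NNReal using hq
  have h := NNReal.geom_mean_le_arith_mean2_weighted a.toNNReal b.toNNReal p q
    (by rw [← Real.toNNReal_add ha.le hb.le, hab, Real.toNNReal_one])
  rw [Real.coe_toNNReal _ ha.le, Real.coe_toNNReal _ hb.le] at h
  rw [← ENNReal.coe_rpow_of_nonneg _ ha.le, ← ENNReal.coe_rpow_of_nonneg _ hb.le]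
  simp only [ENNReal.ofReal]
  exact_mod_cast h

theorem min_le_rpow_mul_rpow {a b : ℝ} (ha : 0 ≤ a) (hb : 0 ≤ b) (hab : a + b = 1) (p q : ℝ≥0∞) :
    min p q ≤ p ^ a * q ^ b :=
  calc min p q = min p q ^ a * min p q ^ b := by
        rw [← ENNReal.rpow_add_of_nonneg _ _ ha hb, hab, ENNReal.rpow_one]
    _ ≤ p ^ a * q ^ b := by
        gcongr
        exacts [min_le_left _ _, min_le_right _ _]

theorem prekopa_leindler_real_of_bounded {a b : ℝ} (ha : 0 < a) (hb : 0 < b) (hab : a + b = 1)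
    {f g h : ℝ → ℝ≥0∞} (hf : Measurable f) (hg : Measurable g) (hh : Measurable h)
    (hf_bdd : ⨆ x, f x ≠ ⊤) (hg_bdd : ⨆ x, g x ≠ ⊤)
    (hfgh : ∀ x y, f x ^ a * g y ^ b ≤ h (a * x + b * y)) :
    (∫⁻ x, f x) ^ a * (∫⁻ x, g x) ^ b ≤ ∫⁻ x, h x := by
  rcases eq_or_ne (⨆ x, f x) 0 with hf₀ | hf₀
  · simp [ENNReal.iSup_eq_zero.1 hf₀, ha]
  rcases eq_or_ne (⨆ x, g x) 0 with hg₀ | hg₀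
  · simp [ENNReal.iSup_eq_zero.1 hg₀, hb]
  set F := ⨆ x, f x
  set G := ⨆ x, g x
  have hFa₀ : F ^ a ≠ 0 := by simp [hf₀, hf_bdd]
  have hFa : F ^ a ≠ ⊤ := ENNReal.rpow_ne_top_of_nonneg ha.le hf_bdd
  have hc₀ : F ^ a * G ^ b ≠ 0 := mul_ne_zero hFa₀ (by simp [hg₀, hg_bdd])
  have hc : F ^ a * G ^ b ≠ ⊤ := ENNReal.mul_ne_top hFa (ENNReal.rpow_ne_top_of_nonneg hb.le hg_bdd)
  have hscale (p q : ℝ≥0∞) :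
      (F⁻¹ * p) ^ a * (G⁻¹ * q) ^ b = (F ^ a * G ^ b)⁻¹ * (p ^ a * q ^ b) := by
    rw [ENNReal.mul_rpow_of_nonneg _ _ ha.le, ENNReal.mul_rpow_of_nonneg _ _ hb.le,
      ENNReal.inv_rpow, ENNReal.inv_rpow, mul_mul_mul_comm,
      ← ENNReal.mul_inv (Or.inl hFa₀) (Or.inl hFa)]
  -- after rescaling, `f` and `g` have the same supremum `1`
  have hadd : ENNReal.ofReal a * (∫⁻ x, F⁻¹ * f x) + ENNReal.ofReal b * (∫⁻ x, G⁻¹ * g x) ≤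
      ∫⁻ x, (F ^ a * G ^ b)⁻¹ * h x := by
    refine ofReal_mul_lintegral_add_le ha hb (hf.const_mul _) (hg.const_mul _) (hh.const_mul _)
      ?_ fun x y => ?_
    · rw [← ENNReal.mul_iSup, ← ENNReal.mul_iSup, ENNReal.inv_mul_cancel hf₀ hf_bdd,
        ENNReal.inv_mul_cancel hg₀ hg_bdd]
    · calc min (F⁻¹ * f x) (G⁻¹ * g y) ≤ (F⁻¹ * f x) ^ a * (G⁻¹ * g y) ^ b :=
            min_le_rpow_mul_rpow ha.le hb.le hab _ _
        _ = (F ^ a * G ^ b)⁻¹ * (f x ^ a * g y ^ b) := hscale _ _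
        _ ≤ (F ^ a * G ^ b)⁻¹ * h (a * x + b * y) := by gcongr; exact hfgh x y
  rw [lintegral_const_mul _ hf, lintegral_const_mul _ hg, lintegral_const_mul _ hh] at hadd
  have hmul := (ennreal_geom_mean_le ha hb hab _ _).trans hadd
  rw [hscale] at hmul
  exact (ENNReal.mul_le_mul_iff_right (ENNReal.inv_ne_zero.2 hc) (ENNReal.inv_ne_top.2 hc₀)).1 hmul

theorem tendsto_lintegral_min_natCast {α : Type*} [MeasurableSpace α] {μ : Measure α}
    {f : α → ℝ≥0∞} (hf : Measurable f) :
    Tendsto (fun N : ℕ => ∫⁻ x, min (f x) N ∂μ) atTop (𝓝 (∫⁻ x, f x ∂μ)) := by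
  refine lintegral_tendsto_of_tendsto_of_monotone
    (fun N => (hf.min measurable_const).aemeasurable)
    (ae_of_all _ fun x M N hMN => min_le_min_left _ (by exact_mod_cast hMN))
    (ae_of_all _ fun x => ?_)
  have h : Tendsto (fun N : ℕ => min (f x) (N : ℝ≥0∞)) atTop (𝓝 (min (f x) ⊤)) :=
    tendsto_const_nhds.min ENNReal.tendsto_nat_nhds_top
  simpa using h

theorem prekopa_leindler_real {a b : ℝ} (ha : 0 < a) (hb : 0 < b) (hab : a + b = 1)
    {f g h : ℝ → ℝ≥0∞} (hf : Measurable f) (hg : Measurable g) (hh : Measurable h)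
    (hfgh : ∀ x y, f x ^ a * g y ^ b ≤ h (a * x + b * y)) :
    (∫⁻ x, f x) ^ a * (∫⁻ x, g x) ^ b ≤ ∫⁻ x, h x := by
  rcases eq_or_ne (∫⁻ x, f x) 0 with hf₀ | hf₀
  · simp [hf₀, ha]
  rcases eq_or_ne (∫⁻ x, g x) 0 with hg₀ | hg₀
  · simp [hg₀, hb]
  have hbdd (f : ℝ → ℝ≥0∞) (N : ℕ) : ⨆ x, min (f x) N ≠ ⊤ :=
    ne_top_of_le_ne_top (ENNReal.natCast_ne_top N) (iSup_le fun x => min_le_right _ _)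
  refine le_of_tendsto' (ENNReal.Tendsto.mul
    ((tendsto_lintegral_min_natCast hf).ennrpow_const a) (Or.inl (by simp [hf₀, ha.le]))
    ((tendsto_lintegral_min_natCast hg).ennrpow_const b)
    (Or.inl (by simp [hg₀, hb.le]))) fun N => ?_
  refine prekopa_leindler_real_of_bounded ha hb hab (hf.min measurable_const)
    (hg.min measurable_const) hh (hbdd f N) (hbdd g N) fun x y => le_trans ?_ (hfgh x y)
  gcongr <;> exact min_le_left _ _

theorem prekopa_leindler {a b : ℝ} (ha : 0 < a) (hb : 0 < b) (hab : a + b = 1) (n : ℕ)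
    {f g h : (Fin n → ℝ) → ℝ≥0∞} (hf : Measurable f) (hg : Measurable g) (hh : Measurable h)
    (hfgh : ∀ x y, f x ^ a * g y ^ b ≤ h (a • x + b • y)) :
    (∫⁻ x, f x) ^ a * (∫⁻ x, g x) ^ b ≤ ∫⁻ x, h x := by
  induction n with
  | zero =>
    have hpoint (f : (Fin 0 → ℝ) → ℝ≥0∞) : ∫⁻ x, f x = f 0 := by
      rw [lintegral_unique, volume_pi, Measure.pi_of_empty, measure_univ, mul_one]
      exact congrArg f (Subsingleton.elim _ _)
    simpa only [hpoint, Subsingleton.elim _ (0 : Fin 0 → ℝ)] using hfgh 0 0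
  | succ n ih =>
    let e := (MeasurableEquiv.piFinSuccAbove (fun _ : Fin (n + 1) => ℝ) 0).symm
    have he : MeasurePreserving e :=
      (volume_preserving_piFinSuccAbove (fun _ : Fin (n + 1) => ℝ) 0).symm _
    have htonelli (f : (Fin (n + 1) → ℝ) → ℝ≥0∞) (hf : Measurable f) :
        ∫⁻ x, f x = ∫⁻ t : ℝ, ∫⁻ y : Fin n → ℝ, f (e (t, y)) := by
      rw [← he.lintegral_comp hf]
      exact lintegral_prod _ (hf.comp e.measurable).aemeasurable
    have hslice {f : (Fin (n + 1) → ℝ) → ℝ≥0∞} (hf : Measurable f) (t : ℝ) :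
        Measurable fun y : Fin n → ℝ => f (e (t, y)) :=
      hf.comp (e.measurable.comp measurable_prodMk_left)
    have hint {f : (Fin (n + 1) → ℝ) → ℝ≥0∞} (hf : Measurable f) :
        Measurable fun t : ℝ => ∫⁻ y : Fin n → ℝ, f (e (t, y)) :=
      (hf.comp e.measurable).lintegral_prod_right'
    rw [htonelli f hf, htonelli g hg, htonelli h hh]
    refine prekopa_leindler_real ha hb hab (hint hf) (hint hg) (hint hh) fun s t =>
      ih (hslice hf s) (hslice hg t) (hslice hh _) fun x y => (hfgh _ _).trans_eq ?_
    congr 1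
    ext i
    refine Fin.cases ?_ (fun i => ?_) i <;> simp [e, MeasurableEquiv.piFinSuccAbove]

/-! ### Wirtinger's inequality for unimodal weights -/

theorem sq_mul_integral_sub_left_sq_le {G G' : ℝ → ℝ} (hG : ∀ t, HasDerivAt G (G' t) t)
    (hG' : Continuous G') {a b κ : ℝ} (hab : a ≤ b) (hκ : 0 ≤ κ) (hκb : κ * (b - a) < Real.pi / 2) :
    κ ^ 2 * ∫ t in a..b, (G t - G a) ^ 2 ≤ ∫ t in a..b, G' t ^ 2 := by
  have hGc : Continuous G := continuous_iff_continuousAt.2 fun t => (hG t).continuousAt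
  have hcos : ∀ t ∈ Icc a b, Real.cos (κ * (b - t)) ≠ 0 := fun t ht => by
    have h₀ : 0 ≤ κ * (b - t) := mul_nonneg hκ (sub_nonneg.2 ht.2)
    have h₁ : κ * (b - t) ≤ κ * (b - a) := by gcongr; exact ht.1
    exact (Real.cos_pos_of_mem_Ioo ⟨by linarith [Real.pi_pos], by linarith⟩).ne'
  -- a primitive of a lower bound of `G' ^ 2 - κ ^ 2 * (G - G a) ^ 2`, vanishing at `a` and `b`
  let Φ : ℝ → ℝ := fun t => κ * Real.tan (κ * (b - t)) * (G t - G a) ^ 2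
  have hΦ : ∀ t ∈ Icc a b, HasDerivAt Φ
      (-κ ^ 2 * (1 + Real.tan (κ * (b - t)) ^ 2) * (G t - G a) ^ 2 +
        κ * Real.tan (κ * (b - t)) * (2 * (G t - G a) * G' t)) t := fun t ht => by
    have harg : HasDerivAt (fun t => κ * (b - t)) (κ * -1) t :=
      ((hasDerivAt_id t).const_sub b).const_mul κ
    have htan := ((Real.hasDerivAt_tan (hcos t ht)).comp t harg).const_mul κ
    refine (htan.mul (((hG t).sub_const (G a)).pow 2)).congr_deriv ?_
    rw [one_div, ← Real.inv_one_add_tan_sq (hcos t ht), inv_inv]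
    simp only [Function.comp_apply, Pi.pow_apply, Nat.cast_ofNat, Nat.add_one_sub_one, pow_one]
    ring
  have hint := intervalIntegral.sub_le_integral_of_hasDeriv_right_of_le
    (φ := fun t => G' t ^ 2 - κ ^ 2 * (G t - G a) ^ 2) hab
    (fun t ht => (hΦ t ht).continuousAt.continuousWithinAt)
    (fun t ht => (hΦ t (Ioo_subset_Icc_self ht)).hasDerivWithinAt)
    (Continuous.integrableOn_Icc (by fun_prop)) fun t _ => by
      nlinarith [sq_nonneg (G' t - κ * Real.tan (κ * (b - t)) * (G t - G a))]
  have hΦ_ends : Φ b - Φ a = 0 := by simp [Φ]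
  rw [hΦ_ends, intervalIntegral.integral_sub (Continuous.intervalIntegrable (by fun_prop) _ _)
    (Continuous.intervalIntegrable (by fun_prop) _ _), intervalIntegral.integral_const_mul] at hint
  linarith

theorem integral_sub_left_sq_le {G G' : ℝ → ℝ} (hG : ∀ t, HasDerivAt G (G' t) t)
    (hG' : Continuous G') {a b : ℝ} (hab : a ≤ b) :
    ∫ t in a..b, (G t - G a) ^ 2 ≤ (2 * (b - a) / Real.pi) ^ 2 * ∫ t in a..b, G' t ^ 2 := by
  rcases hab.eq_or_lt with rfl | hab
  · simp
  set I := ∫ t in a..b, (G t - G a) ^ 2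
  have hpos : 0 < Real.pi / (2 * (b - a)) := div_pos Real.pi_pos (by linarith)
  have hlim : Tendsto (fun κ : ℝ => κ ^ 2 * I) (𝓝[<] (Real.pi / (2 * (b - a))))
      (𝓝 ((Real.pi / (2 * (b - a))) ^ 2 * I)) :=
    (Continuous.tendsto (by fun_prop) _).mono_left nhdsWithin_le_nhds
  have hle : (Real.pi / (2 * (b - a))) ^ 2 * I ≤ ∫ t in a..b, G' t ^ 2 := by
    refine le_of_tendsto hlim ?_
    filter_upwards [Ioo_mem_nhdsLT hpos] with κ hκ
    have hκb := (lt_div_iff₀ (by linarith)).1 hκ.2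
    exact sq_mul_integral_sub_left_sq_le hG hG' hab.le hκ.1.le (by linarith)
  rwa [← inv_div, inv_pow, ← div_eq_inv_mul, le_div_iff₀' (by positivity)]

theorem setLIntegral_Ioo_sub_left_sq_le {G G' : ℝ → ℝ} (hG : ∀ t, HasDerivAt G (G' t) t)
    (hG' : Continuous G') {a b : ℝ} (hab : a ≤ b) :
    ∫⁻ t in Ioo a b, ENNReal.ofReal ((G t - G a) ^ 2) ≤
      ∫⁻ t in Ioo a b, ENNReal.ofReal ((2 * (b - a) / Real.pi) ^ 2 * G' t ^ 2) := by
  have hGc : Continuous G := continuous_iff_continuousAt.2 fun t => (hG t).continuousAt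
  have hreal {u : ℝ → ℝ} (hu : Continuous u) (hu₀ : ∀ t, 0 ≤ u t) :
      ∫⁻ t in Ioo a b, ENNReal.ofReal (u t) = ENNReal.ofReal (∫ t in a..b, u t) := by
    rw [intervalIntegral.integral_of_le hab, setLIntegral_congr Ioo_ae_eq_Ioc,
      ofReal_integral_eq_lintegral_ofReal (hu.integrableOn_Icc.mono_set Ioc_subset_Icc_self)
        (ae_of_all _ hu₀)]
  rw [hreal (by fun_prop) fun t => by positivity, hreal (by fun_prop) fun t => by positivity,
    intervalIntegral.integral_const_mul]
  exact ENNReal.ofReal_le_ofReal (integral_sub_left_sq_le hG hG' hab)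

theorem setLIntegral_le_of_forall_Ioo {S : Set ℝ} {a c : ℝ} (hS : S ⊆ Ioc a c)
    (hS_low : ∀ s t, a < s → s < t → t ∈ S → s ∈ S) {u w : ℝ → ℝ≥0∞}
    (huw : ∀ b, a ≤ b → b ≤ c → ∫⁻ t in Ioo a b, u t ≤ ∫⁻ t in Ioo a b, w t) :
    ∫⁻ t in S, u t ≤ ∫⁻ t in S, w t := by
  rcases S.eq_empty_or_nonempty with rfl | hne
  · simp
  have hbdd : BddAbove S := ⟨c, fun t ht => (hS ht).2⟩
  have hsub : Ioo a (sSup S) ⊆ S := fun s hs =>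
    have ⟨t, ht, hst⟩ := exists_lt_of_lt_csSup hne hs.2
    hS_low s t hs.1 hst ht
  have hsup : S ⊆ Ioc a (sSup S) := fun t ht => ⟨(hS ht).1, le_csSup hbdd ht⟩
  have hae : S =ᵐ[volume] Ioo a (sSup S) :=
    (hsup.eventuallyLE.trans Ioo_ae_eq_Ioc.symm.le).antisymm hsub.eventuallyLE
  rw [setLIntegral_congr hae, setLIntegral_congr hae]
  obtain ⟨t, ht⟩ := hne
  exact huw _ ((hS ht).1.le.trans (le_csSup hbdd ht)) (csSup_le ⟨t, ht⟩ fun s hs => (hS hs).2)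

theorem setLIntegral_mul_eq_lintegral_superlevel {A u : ℝ → ℝ≥0∞} (hA : Measurable A)
    (hu : Measurable u) (S : Set ℝ) :
    ∫⁻ t in S, A t * u t =
      ∫⁻ s in Ioi (0 : ℝ), ∫⁻ t in {t | ENNReal.ofReal s < A t} ∩ S, u t := by
  have h := lintegral_eq_lintegral_measure_ofReal_lt ((volume.restrict S).withDensity u) hA
  rw [lintegral_withDensity_eq_lintegral_mul _ hu hA] at h
  simp only [Pi.mul_apply, mul_comm (u _)] at h
  rw [h]
  refine lintegral_congr fun s => ?_
  have hs : MeasurableSet {t | ENNReal.ofReal s < A t} := measurableSet_lt measurable_const hA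
  rw [withDensity_apply _ hs, Measure.restrict_restrict hs]

theorem setLIntegral_mul_le_of_antitoneOn {A : ℝ → ℝ≥0∞} (hA : Measurable A) {a c : ℝ}
    (hA_anti : AntitoneOn A (Ioi a)) (hA_supp : ∀ t, A t ≠ 0 → t ≤ c) {u w : ℝ → ℝ≥0∞}
    (hu : Measurable u) (hw : Measurable w)
    (huw : ∀ b, a ≤ b → b ≤ c → ∫⁻ t in Ioo a b, u t ≤ ∫⁻ t in Ioo a b, w t) :
    ∫⁻ t in Ioi a, A t * u t ≤ ∫⁻ t in Ioi a, A t * w t := by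
  rw [setLIntegral_mul_eq_lintegral_superlevel hA hu,
    setLIntegral_mul_eq_lintegral_superlevel hA hw]
  refine lintegral_mono fun s => setLIntegral_le_of_forall_Ioo (a := a) (c := c)
    (fun t ht => ⟨ht.2, hA_supp t (pos_of_gt ht.1).ne'⟩) (fun r t hr hrt ht => ?_) huw
  exact ⟨ht.1.trans_le (hA_anti hr ht.2 hrt.le), hr⟩

theorem setLIntegral_Ioi_mul_sub_sq_le {A : ℝ → ℝ≥0∞} (hA : Measurable A) {c H : ℝ}
    (hA_anti : AntitoneOn A (Ioi c)) (hA_supp : ∀ t, A t ≠ 0 → t ≤ c + H)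
    {G G' : ℝ → ℝ} (hG : ∀ t, HasDerivAt G (G' t) t) (hG' : Continuous G') :
    ∫⁻ t in Ioi c, A t * ENNReal.ofReal ((G t - G c) ^ 2) ≤
      ∫⁻ t in Ioi c, A t * ENNReal.ofReal ((2 * H / Real.pi) ^ 2 * G' t ^ 2) := by
  have hGc : Continuous G := continuous_iff_continuousAt.2 fun t => (hG t).continuousAt
  refine setLIntegral_mul_le_of_antitoneOn hA hA_anti hA_supp (by fun_prop) (by fun_prop)
    fun b hcb hbH => (setLIntegral_Ioo_sub_left_sq_le hG hG' hcb).trans ?_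
  have : 0 ≤ b - c := sub_nonneg.2 hcb
  gcongr
  linarith

theorem lintegral_eq_setLIntegral_Iio_add_Ioi (u : ℝ → ℝ≥0∞) (c : ℝ) :
    ∫⁻ t, u t = (∫⁻ t in Iio c, u t) + ∫⁻ t in Ioi c, u t := by
  rw [← lintegral_add_compl u (measurableSet_Iio (a := c)), compl_Iio,
    setLIntegral_congr Ioi_ae_eq_Ici]

theorem setLIntegral_Ioi_comp_neg (u : ℝ → ℝ≥0∞) (c : ℝ) :
    ∫⁻ t in Ioi (-c), u (-t) = ∫⁻ t in Iio c, u t := by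
  simpa using (Measure.measurePreserving_neg (volume : Measure ℝ)).setLIntegral_comp_preimage_emb
    (MeasurableEquiv.neg ℝ).measurableEmbedding u (Iio c)

theorem lintegral_mul_sub_sq_le_of_unimodal {A : ℝ → ℝ≥0∞} (hA : Measurable A) {c H : ℝ}
    (hA_mono : MonotoneOn A (Iio c)) (hA_anti : AntitoneOn A (Ioi c))
    (hA_supp : ∀ t, A t ≠ 0 → |t - c| ≤ H)
    {G G' : ℝ → ℝ} (hG : ∀ t, HasDerivAt G (G' t) t) (hG' : Continuous G') :
    ∫⁻ t, A t * ENNReal.ofReal ((G t - G c) ^ 2) ≤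
      ∫⁻ t, A t * ENNReal.ofReal ((2 * H / Real.pi) ^ 2 * G' t ^ 2) := by
  have hright := setLIntegral_Ioi_mul_sub_sq_le (H := H) hA hA_anti
    (fun t ht => by linarith [(abs_le.1 (hA_supp t ht)).2]) hG hG'
  have hleft := setLIntegral_Ioi_mul_sub_sq_le (A := fun t => A (-t)) (c := -c) (H := H)
    (hA.comp measurable_neg)
    (fun s hs t ht hst => hA_mono (neg_lt.1 (mem_Ioi.1 ht)) (neg_lt.1 (mem_Ioi.1 hs))
      (neg_le_neg hst))
    (fun t ht => by linarith [(abs_le.1 (hA_supp _ ht)).1])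
    (G := fun t => G (-t)) (G' := fun t => -G' (-t))
    (fun t => by simpa [Function.comp_def] using (hG (-t)).comp t (hasDerivAt_neg t))
    (by fun_prop)
  simp only [neg_neg, neg_sq] at hleft
  rw [setLIntegral_Ioi_comp_neg fun t => A t * ENNReal.ofReal ((G t - G c) ^ 2),
    setLIntegral_Ioi_comp_neg fun t => A t * ENNReal.ofReal (_ * G' t ^ 2)] at hleft
  rw [lintegral_eq_setLIntegral_Iio_add_Ioi _ c,
    lintegral_eq_setLIntegral_Iio_add_Ioi (fun t => A t * ENNReal.ofReal (_ * G' t ^ 2)) c]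
  exact add_le_add hleft hright

theorem min_le_of_quasiconcaveOn {β : Type*} [LinearOrder β] {A : ℝ → β}
    (hA : QuasiconcaveOn ℝ univ A) {x y z : ℝ} (hz : z ∈ Icc x y) : min (A x) (A y) ≤ A z :=
  ((hA (min (A x) (A y))).ordConnected.out ⟨mem_univ x, min_le_left _ _⟩
    ⟨mem_univ y, min_le_right _ _⟩ hz).2

theorem exists_mode_of_quasiconcaveOn {β : Type*} [LinearOrder β] [OrderBot β] {A : ℝ → β}
    (hA : QuasiconcaveOn ℝ univ A) {H : ℝ} (hA_supp : ∀ s t, A s ≠ ⊥ → A t ≠ ⊥ → |s - t| ≤ H) :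
    ∃ c, MonotoneOn A (Iio c) ∧ AntitoneOn A (Ioi c) ∧ ∀ t, A t ≠ ⊥ → |t - c| ≤ H := by
  by_cases hne : ∃ t, A t ≠ ⊥
  swap
  · have hbot : A = fun _ => ⊥ := funext (by simpa using hne)
    exact ⟨0, by simp [hbot, monotoneOn_const, antitoneOn_const]⟩
  let L : Set ℝ := {t | ∃ t', t < t' ∧ A t < A t'}
  have hL_lt : ∀ {s t}, A t ≠ ⊥ → s < t - H → s ∈ L := fun {s t} ht hst => by
    have hsH : H < |s - t| := (by linarith : H < -(s - t)).trans_le (neg_le_abs _)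
    have hs : A s = ⊥ := by_contra fun hs => (hA_supp s t hs ht).not_gt hsH
    have hH : 0 ≤ H := (abs_nonneg _).trans (hA_supp t t ht ht)
    exact ⟨t, by linarith, hs ▸ bot_lt_iff_ne_bot.2 ht⟩
  have hL_le : ∀ {s t}, A t ≠ ⊥ → s ∈ L → s ≤ t + H := by
    rintro s t ht ⟨t', hst', hlt⟩
    linarith [(abs_le.1 (hA_supp t' t (bot_le.trans_lt hlt).ne' ht)).2]
  obtain ⟨t₀, ht₀⟩ := hne
  have hL_ne : L.Nonempty := ⟨t₀ - H - 1, hL_lt ht₀ (by linarith)⟩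
  have hL_bdd : BddAbove L := ⟨t₀ + H, fun s => hL_le ht₀⟩
  have hmono : ∀ {s t}, s ≤ t → t ∈ L → A s ≤ A t := by
    rintro s t hst ⟨t', htt', hlt⟩
    exact (min_le_iff.1 (min_le_of_quasiconcaveOn hA ⟨hst, htt'.le⟩)).resolve_right hlt.not_ge
  have hL_low : ∀ {s t}, s ≤ t → t ∈ L → s ∈ L := by
    rintro s t hst ⟨t', htt', hlt⟩
    exact ⟨t', hst.trans_lt htt', (hmono hst ⟨t', htt', hlt⟩).trans_lt hlt⟩
  refine ⟨sSup L, fun s _ t ht hst => ?_, fun s hs t _ hst => ?_, fun t ht => abs_le.2 ⟨?_, ?_⟩⟩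
  · obtain ⟨t', ht', htt'⟩ := exists_lt_of_lt_csSup hL_ne ht
    exact hmono hst (hL_low htt'.le ht')
  · rcases hst.eq_or_lt with rfl | hst
    · exact le_rfl
    · exact not_lt.1 fun hlt => (le_csSup hL_bdd ⟨t, hst, hlt⟩).not_gt hs
  · linarith [csSup_le hL_ne fun s hs => hL_le ht hs]
  · have hle : t - H ≤ sSup L :=
      le_of_forall_lt_imp_le_of_dense fun s hs => le_csSup hL_bdd (hL_lt ht hs)
    linarith

/-! ### Functions of one coordinate on a convex set -/

theorem quasiconcaveOn_volume_slice {n : ℕ} {K : Set (ℝ × (Fin n → ℝ))} (hK : Convex ℝ K)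
    (hK_meas : MeasurableSet K) :
    QuasiconcaveOn ℝ univ fun t => volume (Prod.mk t ⁻¹' K) := by
  refine quasiconcaveOn_iff_min_le.2 ⟨convex_univ, fun s _ t _ a b ha hb hab => ?_⟩
  rcases ha.eq_or_lt with rfl | ha
  · obtain rfl : b = 1 := by linarith
    simp
  rcases hb.eq_or_lt with rfl | hb
  · obtain rfl : a = 1 := by linarith
    simp
  have hslice (t : ℝ) : MeasurableSet (Prod.mk t ⁻¹' K : Set (Fin n → ℝ)) :=
    measurable_prodMk_left hK_meas
  have hmeas (t : ℝ) :
      Measurable ((Prod.mk t ⁻¹' K).indicator (1 : (Fin n → ℝ) → ℝ≥0∞)) :=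
    measurable_const.indicator (hslice t)
  have hPL := prekopa_leindler ha hb hab n (hmeas s) (hmeas t) (hmeas (a • s + b • t))
    fun u v => by
      by_cases hu : (s, u) ∈ K
      · by_cases hv : (t, v) ∈ K
        · have huv : (a • s + b • t, a • u + b • v) ∈ K := hK hu hv ha.le hb.le hab
          rw [indicator_of_mem (mem_preimage.2 hu), indicator_of_mem (mem_preimage.2 hv),
            indicator_of_mem (mem_preimage.2 huv)]
          simp
        · simp [indicator, hv, hb]
      · simp [indicator, hu, ha]
  rw [lintegral_indicator_one (hslice _), lintegral_indicator_one (hslice _),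
    lintegral_indicator_one (hslice _)] at hPL
  exact (min_le_rpow_mul_rpow ha.le hb.le hab _ _).trans hPL

theorem setLIntegral_comp_fst {β : Type*} [MeasureSpace β] [SFinite (volume : Measure β)]
    {K : Set (ℝ × β)} (hK : MeasurableSet K) {u : ℝ → ℝ≥0∞} (hu : Measurable u) :
    ∫⁻ x in K, u x.1 = ∫⁻ t, volume (Prod.mk t ⁻¹' K) * u t := by
  rw [← lintegral_indicator hK, Measure.volume_eq_prod,
    lintegral_prod _ (by exact ((hu.comp measurable_fst).indicator hK).aemeasurable)]
  refine lintegral_congr fun t => ?_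
  rw [mul_comm, ← setLIntegral_const, ← lintegral_indicator (measurable_prodMk_left hK)]
  rfl

theorem exists_setLIntegral_prod_sub_sq_le {n : ℕ} {K : Set (ℝ × (Fin n → ℝ))}
    (hK : Convex ℝ K) (hK_meas : MeasurableSet K) {H : ℝ}
    (hKH : ∀ x ∈ K, ∀ y ∈ K, |x.1 - y.1| ≤ H) {G G' : ℝ → ℝ}
    (hG : ∀ t, HasDerivAt G (G' t) t) (hG' : Continuous G') :
    ∃ m, ∫⁻ x in K, ENNReal.ofReal ((G x.1 - m) ^ 2) ≤
      ∫⁻ x in K, ENNReal.ofReal ((2 * H / Real.pi) ^ 2 * G' x.1 ^ 2) := by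
  have hGc : Continuous G := continuous_iff_continuousAt.2 fun t => (hG t).continuousAt
  have hne {t : ℝ} (ht : volume (Prod.mk t ⁻¹' K) ≠ 0) : ∃ y, (t, y) ∈ K :=
    nonempty_of_measure_ne_zero ht
  obtain ⟨c, hmono, hanti, hsupp⟩ :=
    exists_mode_of_quasiconcaveOn (quasiconcaveOn_volume_slice hK hK_meas) (H := H)
      fun s t hs ht => by
        obtain ⟨⟨x, hx⟩, y, hy⟩ := hne hs, hne ht
        exact hKH _ hx _ hy
  refine ⟨G c, ?_⟩
  rw [setLIntegral_comp_fst hK_meas (u := fun t => ENNReal.ofReal ((G t - G c) ^ 2))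
      (by fun_prop),
    setLIntegral_comp_fst hK_meas (u := fun t => ENNReal.ofReal (_ * G' t ^ 2)) (by fun_prop)]
  exact lintegral_mul_sub_sq_le_of_unimodal (measurable_measure_prodMk_left hK_meas) hmono hanti
    hsupp hG hG'

/-! ### Bisection and needles -/

theorem continuous_setIntegral_pos {X Θ : Type*} [MeasurableSpace X] [TopologicalSpace Θ]
    [FirstCountableTopology Θ] {μ : Measure X} {h : Θ → X → ℝ} (hh_meas : ∀ θ, Measurable (h θ))
    (hh_cont : ∀ x, Continuous fun θ => h θ x) (hh_ne : ∀ θ, ∀ᵐ x ∂μ, h θ x ≠ 0) {f : X → ℝ}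
    (hf : Integrable f μ) : Continuous fun θ => ∫ x in {x | 0 < h θ x}, f x ∂μ := by
  have hmeas (θ : Θ) : MeasurableSet {x | 0 < h θ x} :=
    measurableSet_lt measurable_const (hh_meas θ)
  simp only [← integral_indicator (hmeas _)]
  refine continuous_iff_continuousAt.2 fun θ₀ => ?_
  refine continuousAt_of_dominated (bound := fun x => ‖f x‖)
    (.of_forall fun θ => (hf.indicator (hmeas θ)).aestronglyMeasurable)
    (.of_forall fun θ => ae_of_all _ fun x => norm_indicator_le_norm_self _ _) hf.norm ?_
  filter_upwards [hh_ne θ₀] with x hx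
  rcases lt_or_gt_of_ne hx with hneg | hpos
  · have hev : ∀ᶠ θ in 𝓝 θ₀, h θ x < 0 :=
      (hh_cont x).continuousAt.eventually_lt continuousAt_const hneg
    exact continuousAt_const.congr <| hev.mono fun θ hθ =>
      (indicator_of_notMem (s := {x | 0 < h θ x}) hθ.le.not_gt f).symm
  · have hev : ∀ᶠ θ in 𝓝 θ₀, 0 < h θ x :=
      continuousAt_const.eventually_lt (hh_cont x).continuousAt hpos
    exact continuousAt_const.congr <| hev.mono fun θ hθ =>
      (indicator_of_mem (s := {x | 0 < h θ x}) hθ f).symm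

theorem setIntegral_pos_add_setIntegral_neg {X : Type*} [MeasurableSpace X] {μ : Measure X}
    {h : X → ℝ} (hh : Measurable h) (hh_ne : ∀ᵐ x ∂μ, h x ≠ 0) {f : X → ℝ} (hf : Integrable f μ) :
    (∫ x in {x | 0 < h x}, f x ∂μ) + ∫ x in {x | h x < 0}, f x ∂μ = ∫ x, f x ∂μ := by
  rw [← integral_add_compl (measurableSet_lt measurable_const hh) hf]
  congr 1
  refine setIntegral_congr_set ?_
  filter_upwards [hh_ne] with x hx
  exact propext ⟨fun hneg : h x < 0 => hneg.not_gt,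
    fun hneg : ¬0 < h x => (not_lt.1 hneg).lt_of_ne hx⟩

theorem exists_angle_setIntegral_eq_zero {X : Type*} [MeasurableSpace X] {μ : Measure X}
    {h : ℝ → X → ℝ} (hh_meas : ∀ θ, Measurable (h θ)) (hh_cont : ∀ x, Continuous fun θ => h θ x)
    (hh_ne : ∀ θ, ∀ᵐ x ∂μ, h θ x ≠ 0) (hh_anti : ∀ θ x, h (θ + Real.pi) x = -h θ x)
    {f g : X → ℝ} (hf : Integrable f μ) (hg : Integrable g μ) (hf₀ : ∫ x, f x ∂μ = 0)
    (hg₀ : 0 < ∫ x, g x ∂μ) :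
    ∃ θ, ∫ x in {x | 0 < h θ x}, f x ∂μ = 0 ∧ 0 < ∫ x in {x | 0 < h θ x}, g x ∂μ := by
  have hsplit {u : X → ℝ} (hu : Integrable u μ) (θ : ℝ) : (∫ x in {x | 0 < h θ x}, u x ∂μ) +
      ∫ x in {x | 0 < h (θ + Real.pi) x}, u x ∂μ = ∫ x, u x ∂μ := by
    simpa only [hh_anti, neg_pos] using
      setIntegral_pos_add_setIntegral_neg (hh_meas θ) (hh_ne θ) hu
  obtain ⟨θ, hθ⟩ : ∃ θ, ∫ x in {x | 0 < h θ x}, f x ∂μ = 0 := by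
    have h₀ := hsplit hf 0
    refine mem_range_of_exists_le_of_exists_ge
      (continuous_setIntegral_pos hh_meas hh_cont hh_ne hf) ?_ ?_
    all_goals by_contra! hc; linarith [hc 0, hc (0 + Real.pi)]
  have hfθ := hsplit hf θ
  have hgθ := hsplit hg θ
  by_cases hpos : 0 < ∫ x in {x | 0 < h θ x}, g x ∂μ
  · exact ⟨θ, hθ, hpos⟩
  · exact ⟨θ + Real.pi, by linarith, by linarith⟩

theorem interior_convexHull_eq_empty_of_forall_dense {F : Type*} [NormedAddCommGroup F]
    [NormedSpace ℝ F] {A D : Set F} (hD : Dense D)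
    (hA : ∀ c ∈ D, ∃ L : F →L[ℝ] ℝ, L ≠ 0 ∧ ∀ x ∈ A, L c ≤ L x) :
    interior (convexHull ℝ A) = ∅ := by
  by_contra hne
  obtain ⟨c, hcA, hcD⟩ := hD.inter_open_nonempty _ isOpen_interior (nonempty_iff_ne_empty.2 hne)
  obtain ⟨L, hL, hLA⟩ := hA c hcD
  have hhull : convexHull ℝ A ⊆ {x | L c ≤ L x} :=
    convexHull_min hLA (convex_halfSpace_ge L.isLinear _)
  have hmin : IsLocalMin L c := mem_of_superset (mem_interior_iff_mem_nhds.1 hcA) hhull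
  exact hL (hmin.hasFDerivAt_eq_zero L.hasFDerivAt)

theorem collinear_of_interior_convexHull_eq_empty {F : Type*} [NormedAddCommGroup F]
    [NormedSpace ℝ F] (hF : Module.finrank ℝ F = 2) {A : Set F}
    (hA : interior (convexHull ℝ A) = ∅) : Collinear ℝ A := by
  have : FiniteDimensional ℝ F := .of_finrank_pos (by lia)
  rcases A.eq_empty_or_nonempty with rfl | hne
  · exact collinear_empty ℝ F
  rw [collinear_iff_finrank_le_one, ← Nat.lt_add_one_iff, one_add_one_eq_two, ← hF]
  refine Submodule.finrank_lt fun htop => ?_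
  have hspan : affineSpan ℝ A = ⊤ :=
    (AffineSubspace.affineSpan_eq_top_iff_vectorSpan_eq_top_of_nonempty ℝ F F hne).2 htop
  exact (interior_convexHull_nonempty_iff_affineSpan_eq_top.2 hspan).ne_empty hA

theorem collinear_of_forall_coordinates {n : Type*} {E : Type*} [AddCommGroup E] [Module ℝ E]
    (b : Module.Basis n ℝ E) {S : Set E}
    (hS : ∀ i j, i ≠ j → Collinear ℝ ((fun x => (b.repr x i, b.repr x j)) '' S)) :
    Collinear ℝ S := by
  rcases S.subsingleton_or_nontrivial with hsub | ⟨x, hx, y, hy, hxy⟩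
  · exact hsub.induction_on (collinear_empty ℝ E) (collinear_singleton ℝ)
  obtain ⟨i, hi⟩ : ∃ i, b.repr (y - x) i ≠ 0 := by
    by_contra! h
    exact hxy (sub_eq_zero.1 (b.ext_elem fun i => by simpa using h i)).symm
  refine (collinear_iff_of_mem hx).2 ⟨y - x, fun z hz => ?_⟩
  refine ⟨b.repr (z - x) i / b.repr (y - x) i, eq_add_of_sub_eq (b.ext_elem fun j => ?_)⟩
  rcases eq_or_ne i j with rfl | hij
  · rw [map_smul, Finsupp.smul_apply, smul_eq_mul, div_mul_cancel₀ _ hi]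
  obtain ⟨v, hv⟩ := (collinear_iff_of_mem (mem_image_of_mem _ hx)).1 (hS i j hij)
  obtain ⟨r, hr⟩ := hv _ (mem_image_of_mem _ hy)
  obtain ⟨s, hs⟩ := hv _ (mem_image_of_mem _ hz)
  simp only [vadd_eq_add, Prod.ext_iff, Prod.fst_add, Prod.snd_add, Prod.smul_fst, Prod.smul_snd,
    smul_eq_mul] at hr hs
  rw [← sub_eq_iff_eq_add, ← sub_eq_iff_eq_add, ← Finsupp.sub_apply, ← Finsupp.sub_apply,
    ← map_sub] at hr hs
  rw [map_smul, Finsupp.smul_apply, smul_eq_mul, div_mul_eq_mul_div, eq_div_iff hi, hr.1, hr.2,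
    hs.1, hs.2]
  ring

theorem exists_unit_direction_of_collinear {E : Type*} [NormedAddCommGroup E]
    [NormedSpace ℝ E] [Nontrivial E] {S : Set E}
    (hS : Collinear ℝ S) : ∃ p e : E, ‖e‖ = 1 ∧ ∀ x ∈ S, ∃ t : ℝ, x = p + t • e := by
  obtain ⟨p, v, hv⟩ := (collinear_iff_exists_forall_eq_smul_vadd S).1 hS
  obtain ⟨e, he, hve⟩ : ∃ e : E, ‖e‖ = 1 ∧ v = ‖v‖ • e := by
    rcases eq_or_ne v 0 with rfl | hv₀
    · obtain ⟨e, he⟩ := exists_norm_eq E zero_le_one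
      exact ⟨e, he, by simp⟩
    · exact ⟨(‖v‖⁻¹ : ℝ) • v, norm_smul_inv_norm hv₀,
        (smul_inv_smul₀ (norm_ne_zero_iff.2 hv₀) v).symm⟩
  refine ⟨p, e, he, fun x hx => ?_⟩
  obtain ⟨r, rfl⟩ := hv x hx
  exact ⟨r * ‖v‖, by rw [mul_smul, ← hve, vadd_eq_add, add_comm]⟩

section Needle

variable {E : Type*} [NormedAddCommGroup E] [NormedSpace ℝ E] [MeasureSpace E]

/-- The convex open sets over which `f` has integral zero and `g` has positive integral: the class
of sets that is stable under suitable bisections. -/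
structure IsBalanced (f g : E → ℝ) (κ : Set E) : Prop where
  isOpen : IsOpen κ
  convex : Convex ℝ κ
  integral_eq_zero : ∫ x in κ, f x = 0
  integral_pos : 0 < ∫ x in κ, g x

theorem IsBalanced.exists_bisection [FiniteDimensional ℝ E] [BorelSpace E]
    [(volume : Measure E).IsAddHaarMeasure] {f g : E → ℝ} {κ : Set E} (hκ : IsBalanced f g κ)
    (hf : IntegrableOn f κ) (hg : IntegrableOn g κ) {T : E →L[ℝ] ℝ × ℝ}
    (hT : Function.Surjective T) (c : ℝ × ℝ) :
    ∃ κ' ⊆ κ, IsBalanced f g κ' ∧ ∃ L : ℝ × ℝ →L[ℝ] ℝ, L ≠ 0 ∧ ∀ x ∈ κ', L c ≤ L (T x) := by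
  let L : ℝ → ℝ × ℝ →L[ℝ] ℝ := fun θ =>
    Real.cos θ • .fst ℝ ℝ ℝ + Real.sin θ • .snd ℝ ℝ ℝ
  have hL_apply (θ : ℝ) (y : ℝ × ℝ) : L θ y = Real.cos θ * y.1 + Real.sin θ * y.2 := rfl
  have hL_ne (θ : ℝ) : L θ ≠ 0 := fun h => by
    have h₁ : L θ (Real.cos θ, Real.sin θ) = 1 := by
      rw [hL_apply]; nlinarith [Real.sin_sq_add_cos_sq θ]
    simp [h] at h₁
  have hnull (θ : ℝ) : ∀ᵐ x ∂volume.restrict κ, L θ (T x) - L θ c ≠ 0 := by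
    have hsurj : Function.Surjective ((L θ).toLinearMap ∘ₗ T.toLinearMap) :=
      (LinearMap.surjective fun h => hL_ne θ (ContinuousLinearMap.coe_injective h)).comp hT
    refine ae_restrict_of_ae <| ((ae_comp_linearMap_mem_iff _ volume volume hsurj
      (measurableSet_singleton (L θ c)).compl).2 ?_).mono fun x hx => sub_ne_zero.2 hx
    exact compl_mem_ae_iff.2 (measure_singleton _)
  have hmeas (θ : ℝ) : MeasurableSet {x | 0 < L θ (T x) - L θ c} :=
    measurableSet_lt measurable_const (by fun_prop)
  obtain ⟨θ, hfθ, hgθ⟩ := exists_angle_setIntegral_eq_zero (μ := volume.restrict κ)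
    (h := fun θ x => L θ (T x) - L θ c) (fun θ => by fun_prop)
    (fun x => by simp only [hL_apply]; fun_prop) hnull
    (fun θ x => by simp only [hL_apply, Real.cos_add_pi, Real.sin_add_pi]; ring) hf hg
    hκ.integral_eq_zero hκ.integral_pos
  rw [Measure.restrict_restrict (hmeas θ), inter_comm] at hfθ hgθ
  refine ⟨_, inter_subset_left, ⟨hκ.isOpen.inter (isOpen_lt continuous_const (by fun_prop)),
    hκ.convex.inter ?_, hfθ, hgθ⟩, L θ, hL_ne θ, fun x hx => (sub_pos.1 hx.2).le⟩
  simp only [sub_pos]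
  exact convex_halfSpace_gt ((L θ).comp T).isLinear (L θ c)

theorem exists_antitone_isBalanced_collinear [FiniteDimensional ℝ E] [BorelSpace E]
    [(volume : Measure E).IsAddHaarMeasure] {f g : E → ℝ} {K : Set E}
    (hK : IsBalanced f g K) (hf : IntegrableOn f K) (hg : IntegrableOn g K) :
    ∃ κ : ℕ → Set E, Antitone κ ∧ (∀ n, IsBalanced f g (κ n) ∧ κ n ⊆ K) ∧
      Collinear ℝ (⋂ n, closure (κ n)) := by
  let b := Module.finBasis ℝ E
  let T (i j : Fin (Module.finrank ℝ E)) : E →L[ℝ] ℝ × ℝ :=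
    ((b.coord i).prod (b.coord j)).toContinuousLinearMap
  have hT {i j} (hij : i ≠ j) : Function.Surjective (T i j) := fun y =>
    ⟨y.1 • b i + y.2 • b j, by simp [T, hij, hij.symm]⟩
  let Balanced := {κ : Set E // IsBalanced f g κ ∧ κ ⊆ K}ᵒᵈ
  let cuts (t : {ij : Fin _ × Fin _ // ij.1 ≠ ij.2} × ℚ × ℚ) : Order.Cofinal Balanced :=
    { carrier := {κ | ∃ L : ℝ × ℝ →L[ℝ] ℝ, L ≠ 0 ∧
        ∀ x ∈ (OrderDual.ofDual κ).1, L (t.2.1, t.2.2) ≤ L (T t.1.1.1 t.1.1.2 x)}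
      isCofinal := fun κ => by
        obtain ⟨κ', hsub, hκ', hL⟩ := κ.2.1.exists_bisection (hf.mono_set κ.2.2)
          (hg.mono_set κ.2.2) (hT t.1.2) (t.2.1, t.2.2)
        exact ⟨OrderDual.toDual ⟨κ', hκ', hsub.trans κ.2.2⟩, hL, hsub⟩ }
  let κ := Order.sequenceOfCofinals (OrderDual.toDual ⟨K, hK, Subset.rfl⟩) cuts
  refine ⟨fun n => (OrderDual.ofDual (κ n)).1,
    fun m n hmn => Order.sequenceOfCofinals.monotone _ cuts hmn,
    fun n => (OrderDual.ofDual (κ n)).2, collinear_of_forall_coordinates b fun i j hij => ?_⟩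
  have hdense : DenseRange fun c : ℚ × ℚ => ((c.1 : ℝ), (c.2 : ℝ)) :=
    Rat.denseRange_cast.prodMap Rat.denseRange_cast
  refine collinear_of_interior_convexHull_eq_empty (by simp)
    (interior_convexHull_eq_empty_of_forall_dense hdense ?_)
  rintro _ ⟨c, rfl⟩
  obtain ⟨L, hL, hLκ⟩ := Order.sequenceOfCofinals.encode_mem
    (OrderDual.toDual ⟨K, hK, Subset.rfl⟩) cuts (⟨(i, j), hij⟩, c)
  refine ⟨L, hL, forall_mem_image.2 fun x hx => ?_⟩
  exact closure_minimal hLκ (isClosed_le continuous_const (L.continuous.comp (T i j).continuous))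
    (mem_iInter.1 hx _)

theorem exists_needle [FiniteDimensional ℝ E] [Nontrivial E] [BorelSpace E]
    [(volume : Measure E).IsAddHaarMeasure] {f g : E → ℝ} {K : Set E} (hK : IsBalanced f g K)
    (hK_bdd : Bornology.IsBounded K) (hf : IntegrableOn f K) (hg : IntegrableOn g K) :
    ∃ p e : E, ‖e‖ = 1 ∧ ∀ U : Set E, IsOpen U → (∀ t : ℝ, p + t • e ∈ U) →
      ∃ κ, IsBalanced f g κ ∧ κ ⊆ K ∧ κ ⊆ U := by
  obtain ⟨κ, hκ_anti, hκ, hcol⟩ := exists_antitone_isBalanced_collinear hK hf hg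
  obtain ⟨p, e, he, hline⟩ := exists_unit_direction_of_collinear hcol
  refine ⟨p, e, he, fun U hU hpU => ?_⟩
  obtain ⟨n, hn⟩ : ∃ n, closure (κ n) ⊆ U := exists_subset_nhds_of_isCompact
    (directed_of_isDirected_le fun m n hmn => closure_mono (hκ_anti hmn))
    (fun n => (hK_bdd.subset (hκ n).2).isCompact_closure) fun x hx => by
      obtain ⟨t, rfl⟩ := hline x hx
      exact hU.mem_nhds (hpU t)
  exact ⟨κ n, (hκ n).1, (hκ n).2, subset_closure.trans hn⟩

end Needle

/-! ### The Poincaré inequality on convex sets -/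

section Space

variable {E : Type*} [NormedAddCommGroup E] [InnerProductSpace ℝ E] [FiniteDimensional ℝ E]
  [MeasurableSpace E] [BorelSpace E]

theorem exists_measurePreserving_prod_fst_eq_inner {e : E} (he : ‖e‖ = 1) :
    ∃ (n : ℕ) (Φ : E ≃L[ℝ] ℝ × (Fin n → ℝ)),
      MeasurePreserving Φ ∧ ∀ x, (Φ x).1 = inner ℝ e x := by
  have hE : 0 < Module.finrank ℝ E :=
    Module.finrank_pos_iff_exists_ne_zero.2 ⟨e, norm_ne_zero_iff.1 (by simp [he])⟩
  obtain ⟨n, hn⟩ := Nat.exists_eq_succ_of_ne_zero hE.ne'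
  have he_orth : Orthonormal ℝ (({0} : Set (Fin (n + 1))).domRestrict fun _ => e) :=
    ⟨fun _ => he, fun i j hij => absurd (Subsingleton.elim i j) hij⟩
  obtain ⟨b, hb⟩ := he_orth.exists_orthonormalBasis_extension_of_card_eq (by simpa using hn)
  refine ⟨n, (b.repr.toContinuousLinearEquiv.trans (EuclideanSpace.equiv (Fin (n + 1)) ℝ)).trans
    (Fin.consEquivL ℝ fun _ => ℝ).symm, ?_, fun x => ?_⟩
  · exact (volume_preserving_piFinSuccAbove (fun _ : Fin (n + 1) => ℝ) 0).comp
      ((PiLp.volume_preserving_ofLp _).comp b.measurePreserving_repr)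
  · rw [← hb 0 rfl, ← b.repr_apply_apply]
    rfl

theorem integrableOn_of_isBounded {u : E → ℝ} (hu : Continuous u) {K : Set E}
    (hK : Bornology.IsBounded K) : IntegrableOn u K :=
  (hu.continuousOn.integrableOn_compact hK.isCompact_closure).mono_set subset_closure

theorem exists_setIntegral_inner_sub_sq_le {K : Set E} (hK : Convex ℝ K)
    (hK_meas : MeasurableSet K) (hK_bdd : Bornology.IsBounded K) {H : ℝ}
    (hKH : ∀ x ∈ K, ∀ y ∈ K, dist x y ≤ H) {e : E} (he : ‖e‖ = 1) {G G' : ℝ → ℝ}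
    (hG : ∀ t, HasDerivAt G (G' t) t) (hG' : Continuous G') :
    ∃ m, ∫ x in K, (G (inner ℝ e x) - m) ^ 2 ≤
      (2 * H / Real.pi) ^ 2 * ∫ x in K, G' (inner ℝ e x) ^ 2 := by
  have hGc : Continuous G := continuous_iff_continuousAt.2 fun t => (hG t).continuousAt
  obtain ⟨n, Φ, hΦ, hΦ_fst⟩ := exists_measurePreserving_prod_fst_eq_inner he
  have hΦ_emb : MeasurableEmbedding Φ := Φ.toHomeomorph.measurableEmbedding
  have hcomp (u : ℝ → ℝ≥0∞) : ∫⁻ x in Φ '' K, u x.1 = ∫⁻ x in K, u (inner ℝ e x) := by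
    rw [← hΦ.setLIntegral_comp_preimage_emb hΦ_emb (fun x => u x.1),
      preimage_image_eq K Φ.injective]
    simp only [hΦ_fst]
  obtain ⟨m, hm⟩ := exists_setLIntegral_prod_sub_sq_le (K := Φ '' K) (H := H)
    (hK.linear_image Φ.toLinearMap) (hΦ_emb.measurableSet_image.2 hK_meas) (by
      rintro _ ⟨x, hx, rfl⟩ _ ⟨y, hy, rfl⟩
      calc |(Φ x).1 - (Φ y).1| = |inner ℝ e (x - y)| := by rw [hΦ_fst, hΦ_fst, inner_sub_right]
        _ ≤ ‖e‖ * ‖x - y‖ := abs_real_inner_le_norm _ _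
        _ ≤ H := by rw [he, one_mul, ← dist_eq_norm]; exact hKH x hx y hy) hG hG'
  rw [hcomp fun t => ENNReal.ofReal ((G t - m) ^ 2),
    hcomp fun t => ENNReal.ofReal (_ * G' t ^ 2)] at hm
  refine ⟨m, ?_⟩
  rw [← integral_const_mul]
  refine (ENNReal.ofReal_le_ofReal_iff (integral_nonneg fun x => by positivity)).1 ?_
  rwa [ofReal_integral_eq_lintegral_ofReal (integrableOn_of_isBounded (by fun_prop) hK_bdd)
      (ae_of_all _ fun x => by positivity),
    ofReal_integral_eq_lintegral_ofReal (integrableOn_of_isBounded (by fun_prop) hK_bdd)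
      (ae_of_all _ fun x => by positivity)]

theorem exists_setIntegral_comp_lineProj_sub_sq_le {K : Set E} (hK : Convex ℝ K)
    (hK_meas : MeasurableSet K) (hK_bdd : Bornology.IsBounded K) {H : ℝ}
    (hKH : ∀ x ∈ K, ∀ y ∈ K, dist x y ≤ H) {f : E → ℝ} (hf : ContDiff ℝ 1 f) (p : E) {e : E}
    (he : ‖e‖ = 1) :
    ∃ m, ∫ x in K, (f (p + (inner ℝ e x - inner ℝ e p) • e) - m) ^ 2 ≤
      (2 * H / Real.pi) ^ 2 *
        ∫ x in K, ‖fderiv ℝ f (p + (inner ℝ e x - inner ℝ e p) • e)‖ ^ 2 := by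
  have : Continuous (fderiv ℝ f) := hf.continuous_fderiv one_ne_zero
  let line : ℝ → E := fun t => p + (t - inner ℝ e p) • e
  have hline (t : ℝ) : HasDerivAt line e t := by
    have := (((hasDerivAt_id t).sub_const (inner ℝ e p)).smul_const e).const_add p
    rwa [one_smul] at this
  have hG (t : ℝ) : HasDerivAt (fun t => f (line t)) (fderiv ℝ f (line t) e) t :=
    (hf.differentiable one_ne_zero _).hasFDerivAt.comp_hasDerivAt t (hline t)
  obtain ⟨m, hm⟩ :=
    exists_setIntegral_inner_sub_sq_le hK hK_meas hK_bdd hKH he hG (by fun_prop)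
  refine ⟨m, hm.trans (mul_le_mul_of_nonneg_left ?_ (sq_nonneg _))⟩
  refine integral_mono (integrableOn_of_isBounded (by fun_prop) hK_bdd)
    (integrableOn_of_isBounded (by fun_prop) hK_bdd) fun x => sq_le_sq.2 ?_
  simpa [he] using (fderiv ℝ f (line (inner ℝ e x))).le_opNorm e

theorem setIntegral_sq_sub_nonpos_of_approx {κ : Set E} (hκ_meas : MeasurableSet κ)
    (hκ_bdd : Bornology.IsBounded κ) {f u q r : E → ℝ} (hf : Continuous f) (hu : Continuous u)
    (hq : Continuous q) (hr : Continuous r) {C m η : ℝ} (hf₀ : ∫ x in κ, f x = 0)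
    (hur : ∫ x in κ, (u x - m) ^ 2 ≤ C * ∫ x in κ, r x)
    (hη : ∀ x ∈ κ, f x ^ 2 - u x ^ 2 + (f x - u x) ^ 2 + C * (r x - q x) ≤ η) :
    ∫ x in κ, (f x ^ 2 - C * q x - η) ≤ 0 := by
  have hpointwise : ∀ x ∈ κ,
      f x ^ 2 - C * q x - η ≤ (u x - m) ^ 2 - C * r x + 2 * m * f x := fun x hx => by
    linarith [hη x hx, sq_nonneg (m - (u x - f x))]
  refine (setIntegral_mono_on (integrableOn_of_isBounded (by fun_prop) hκ_bdd)
    (integrableOn_of_isBounded (by fun_prop) hκ_bdd) hκ_meas hpointwise).trans ?_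
  rw [integral_add (integrableOn_of_isBounded (by fun_prop) hκ_bdd)
      (integrableOn_of_isBounded (by fun_prop) hκ_bdd),
    integral_sub (integrableOn_of_isBounded (by fun_prop) hκ_bdd)
      (integrableOn_of_isBounded (by fun_prop) hκ_bdd), integral_const_mul, integral_const_mul,
    hf₀]
  linarith

theorem setIntegral_sq_le_of_integral_eq_zero [Nontrivial E] {K : Set E} (hK_open : IsOpen K)
    (hK : Convex ℝ K) (hK_bdd : Bornology.IsBounded K) {H : ℝ}
    (hKH : ∀ x ∈ K, ∀ y ∈ K, dist x y ≤ H) {f : E → ℝ} (hf : ContDiff ℝ 1 f)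
    (hf₀ : ∫ x in K, f x = 0) :
    ∫ x in K, f x ^ 2 ≤ (2 * H / Real.pi) ^ 2 * ∫ x in K, ‖fderiv ℝ f x‖ ^ 2 := by
  have hf_cont : Continuous f := hf.continuous
  have : Continuous (fderiv ℝ f) := hf.continuous_fderiv one_ne_zero
  set C := (2 * H / Real.pi) ^ 2
  let q : E → ℝ := fun x => ‖fderiv ℝ f x‖ ^ 2
  have hq : Continuous q := by fun_prop
  by_contra! hlt
  obtain ⟨η, hη, hηK⟩ := exists_pos_mul_lt (sub_pos.2 hlt) (volume.real K)
  let g : E → ℝ := fun x => f x ^ 2 - C * q x - η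
  have hg : Continuous g := by fun_prop
  have hbalanced : IsBalanced f g K := ⟨hK_open, hK, hf₀, by
    rw [integral_sub (integrableOn_of_isBounded (by fun_prop) hK_bdd)
        (integrableOn_of_isBounded (by fun_prop) hK_bdd),
      integral_sub (integrableOn_of_isBounded (by fun_prop) hK_bdd)
        (integrableOn_of_isBounded (by fun_prop) hK_bdd), integral_const_mul, setIntegral_const,
      smul_eq_mul]
    linarith⟩
  obtain ⟨p, e, he, hneedle⟩ := exists_needle hbalanced hK_bdd
    (integrableOn_of_isBounded hf_cont hK_bdd) (integrableOn_of_isBounded hg hK_bdd)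
  let π : E → E := fun x => p + (inner ℝ e x - inner ℝ e p) • e
  have hπ : Continuous π := by fun_prop
  have hπ_line (t : ℝ) : π (p + t • e) = p + t • e := by
    simp [π, inner_add_right, inner_smul_right, he]
  -- on a needle close to the line, replacing `f` and `q` by `f ∘ π` and `q ∘ π` costs at most `η`
  obtain ⟨κ, hκ, hκK, hκU⟩ := hneedle
    {x | f x ^ 2 - f (π x) ^ 2 + (f x - f (π x)) ^ 2 + C * (q (π x) - q x) < η}
    (isOpen_lt (by fun_prop) continuous_const) fun t => by simpa [hπ_line] using hη
  have hκ_bdd := hK_bdd.subset hκK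
  obtain ⟨m, hm⟩ := exists_setIntegral_comp_lineProj_sub_sq_le hκ.convex hκ.isOpen.measurableSet
    hκ_bdd (fun x hx y hy => hKH x (hκK hx) y (hκK hy)) hf p he
  exact hκ.integral_pos.not_ge <| setIntegral_sq_sub_nonpos_of_approx hκ.isOpen.measurableSet
    hκ_bdd hf_cont (hf_cont.comp hπ) hq (hq.comp hπ) hκ.integral_eq_zero hm
    fun x hx => (hκU hx).le

theorem setIntegral_sq_le_add_sq_integral [Nontrivial E] {K : Set E} (hK_open : IsOpen K)
    (hK : Convex ℝ K) (hK_bdd : Bornology.IsBounded K) {H : ℝ}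
    (hKH : ∀ x ∈ K, ∀ y ∈ K, dist x y ≤ H) {f : E → ℝ} (hf : ContDiff ℝ 1 f) :
    ∫ x in K, f x ^ 2 ≤ (2 * H / Real.pi) ^ 2 * (∫ x in K, ‖fderiv ℝ f x‖ ^ 2) +
      (∫ x in K, f x) ^ 2 / volume.real K := by
  have hf_cont : Continuous f := hf.continuous
  rcases K.eq_empty_or_nonempty with rfl | hne
  · simp
  have hV : 0 < volume.real K :=
    ENNReal.toReal_pos (hK_open.measure_pos volume hne).ne' hK_bdd.measure_lt_top.ne
  set c := (∫ x in K, f x) / volume.real K with hc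
  have hmean : ∫ x in K, (f x - c) = 0 := by
    rw [integral_sub (integrableOn_of_isBounded hf_cont hK_bdd)
      (integrableOn_of_isBounded continuous_const hK_bdd), setIntegral_const, smul_eq_mul,
      mul_div_cancel₀ _ hV.ne', sub_self]
  have hpoincare := setIntegral_sq_le_of_integral_eq_zero hK_open hK hK_bdd hKH
    (hf.sub contDiff_const) hmean
  have hsq : ∫ x in K, (f x - c) ^ 2 =
      (∫ x in K, f x ^ 2) - (∫ x in K, f x) ^ 2 / volume.real K := by
    have hexp (x : E) : (f x - c) ^ 2 = f x ^ 2 - c * (2 * f x - c) := by ring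
    simp only [hexp]
    rw [integral_sub (integrableOn_of_isBounded (by fun_prop) hK_bdd)
      (integrableOn_of_isBounded (by fun_prop) hK_bdd), integral_const_mul,
      integral_sub (integrableOn_of_isBounded (by fun_prop) hK_bdd)
      (integrableOn_of_isBounded (by fun_prop) hK_bdd), integral_const_mul, setIntegral_const,
      smul_eq_mul, hc]
    field_simp
    ring
  simp only [fderiv_sub_const, hsq] at hpoincare
  linarith

end Space

/-! ### Bilinear forms and Galerkin approximation -/

section BilinForm

variable {V : Type*} [AddCommGroup V] [Module ℝ V] {B : LinearMap.BilinForm ℝ V}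

theorem form_add_self (hB : B.IsSymm) {u v : V} (huv : B u v = 0) :
    B (u + v) (u + v) = B u u + B v v := by
  have hvu : B v u = 0 := by rw [hB.eq, huv]
  rw [LinearMap.BilinForm.add_left, LinearMap.BilinForm.add_right,
    LinearMap.BilinForm.add_right, huv, hvu, add_zero, zero_add]

theorem sqrt_form_sub_eq_iInf (hB : B.IsPosSemidef) {S : Submodule ℝ V} {u u' : V}
    (hu' : u' ∈ S) (huu' : ∀ v ∈ S, B (u - u') v = 0) :
    √(B (u - u') (u - u')) = ⨅ v : S, √(B (u - v) (u - v)) := by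
  refine le_antisymm (le_ciInf fun v => Real.sqrt_le_sqrt ?_) (ciInf_le
    (f := fun v : S => √(B (u - v) (u - v))) ?_ ⟨u', hu'⟩)
  · rw [← sub_add_sub_cancel u u' v,
      form_add_self hB.isSymm (huu' _ (Submodule.sub_mem _ hu' v.2))]
    exact le_add_of_nonneg_right (hB.nonneg _)
  · exact ⟨0, forall_mem_range.2 fun v => Real.sqrt_nonneg _⟩

variable {ι : Type*} {w : ι → V} [DecidableEq ι]

theorem linearIndependent_of_exists_dual {η : ι → V}
    (hη : ∀ i j, B (η i) (w j) = if i = j then 1 else 0) : LinearIndependent ℝ w :=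
  .of_pairwise_dual_eq_zero_one w (fun i => B (η i)) (fun i j hij => (hη i j).trans (if_neg hij))
    fun i => (hη i i).trans (if_pos rfl)

theorem exists_dual_span_eq [Finite ι] (hB : ∀ v ≠ 0, 0 < B v v) (hw : LinearIndependent ℝ w) :
    ∃ ψ : ι → V, Submodule.span ℝ (range ψ) = Submodule.span ℝ (range w) ∧
      ∀ i j, B (ψ i) (w j) = if i = j then 1 else 0 := by
  let b := Module.Basis.span hw
  have hb : (B.restrict (Submodule.span ℝ (range w))).Nondegenerate := by
    refine ⟨fun v hv => ?_, fun v hv => ?_⟩ <;> by_contra hne <;>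
      exact (hB v (Submodule.coe_eq_zero.not.2 hne)).ne' (hv v)
  let b' := LinearMap.BilinForm.dualBasis _ hb b
  refine ⟨fun i => b' i, ?_, fun i j => ?_⟩
  · have hrange : range (fun i => (b' i : V)) = Submodule.subtype _ '' range b' := by
      rw [← range_comp]; rfl
    rw [hrange, Submodule.span_image, b'.span_eq, Submodule.map_top, Submodule.range_subtype]
  · rw [show w j = b j from
      congrArg Subtype.val (Module.Basis.span_apply hw j).symm]
    exact (LinearMap.BilinForm.apply_dualBasis_left hb b i j).trans (if_congr eq_comm rfl rfl)

end BilinForm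

theorem exists_form_apply_eq_of_isCoercive {V : Type*} [NormedAddCommGroup V]
    [InnerProductSpace ℝ V] [CompleteSpace V] {B : V →L[ℝ] V →L[ℝ] ℝ} (hB : IsCoercive B)
    (ℓ : V →L[ℝ] ℝ) : ∃ w, ∀ v, B w v = ℓ v := by
  refine ⟨hB.continuousLinearEquivOfBilin.symm ((InnerProductSpace.toDual ℝ V).symm ℓ),
    fun v => ?_⟩
  rw [← hB.continuousLinearEquivOfBilin_apply, ContinuousLinearEquiv.apply_symm_apply,
    InnerProductSpace.toDual_symm_apply]

/-! ### The energy form on `H¹₀(Ω)` -/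

section Friedrichs

variable {E : Type*} [NormedAddCommGroup E] [MeasurableSpace E] [BorelSpace E]

theorem integrable_of_hasCompactSupport_of_eq_zero {F : Type*} [Zero F] {μ : Measure E}
    [IsFiniteMeasureOnCompacts μ] {η : E → F} {f : E → ℝ} (hη : HasCompactSupport η)
    (hf : Continuous f) (hf_zero : ∀ x, η x = 0 → f x = 0) : Integrable f μ :=
  hf.integrable_of_hasCompactSupport (hη.mono fun x hx h => hx (hf_zero x h))

theorem integral_sq_eq_neg_integral_fderiv_mul [NormedSpace ℝ E] [FiniteDimensional ℝ E]
    {μ : Measure E} [μ.IsAddHaarMeasure] {η : E → ℝ} (hη : ContDiff ℝ 1 η)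
    (hη_supp : HasCompactSupport η) (c : E →L[ℝ] ℝ) {e : E} (hce : c e = 1) :
    ∫ x, η x ^ 2 ∂μ = -∫ x, 2 * η x * fderiv ℝ η x e * c x ∂μ := by
  have hη_cont : Continuous η := hη.continuous
  have : Continuous fun x => fderiv ℝ η x e :=
    (hη.continuous_fderiv one_ne_zero).clm_apply continuous_const
  have hη_diff : Differentiable ℝ η := hη.differentiable one_ne_zero
  have hsq (x : E) : fderiv ℝ (fun x => η x ^ 2) x e = 2 * η x * fderiv ℝ η x e := by
    simp [fderiv_fun_pow 2 (hη_diff x)]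
  have hc (x : E) : fderiv ℝ (fun x => c x) x e = 1 := by rw [c.fderiv, hce]
  have hparts := integral_mul_fderiv_eq_neg_fderiv_mul_of_integrable
    (μ := μ) (f := fun x => η x ^ 2) (g := fun x => c x) (v := e)
  simp only [hc, hsq, mul_one] at hparts
  exact hparts
    (integrable_of_hasCompactSupport_of_eq_zero hη_supp (by fun_prop) fun x hx => by simp [hx])
    (integrable_of_hasCompactSupport_of_eq_zero hη_supp (by fun_prop) fun x hx => by simp [hx])
    (integrable_of_hasCompactSupport_of_eq_zero hη_supp (by fun_prop) fun x hx => by simp [hx])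
    (fun x _ => (hη_diff x).pow 2) (fun x _ => c.differentiableAt)

theorem integral_sq_le_integral_norm_fderiv_sq [InnerProductSpace ℝ E] [FiniteDimensional ℝ E]
    [Nontrivial E] {μ : Measure E} [μ.IsAddHaarMeasure] {η : E → ℝ} (hη : ContDiff ℝ 1 η)
    (hη_supp : HasCompactSupport η) {R : ℝ} (hR : ∀ x, η x ≠ 0 → ‖x‖ ≤ R) :
    ∫ x, η x ^ 2 ∂μ ≤ 4 * R ^ 2 * ∫ x, ‖fderiv ℝ η x‖ ^ 2 ∂μ := by
  obtain ⟨e, he⟩ := exists_norm_eq E zero_le_one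
  have hη_cont : Continuous η := hη.continuous
  have : Continuous (fderiv ℝ η) := hη.continuous_fderiv one_ne_zero
  have hη_int : Integrable (fun x => η x ^ 2) μ :=
    integrable_of_hasCompactSupport_of_eq_zero hη_supp (by fun_prop) fun x hx => by simp [hx]
  have hderiv_int : Integrable (fun x => ‖fderiv ℝ η x‖ ^ 2) μ :=
    integrable_of_hasCompactSupport_of_eq_zero (hη_supp.fderiv ℝ) (by fun_prop)
      fun x hx => by simp [hx]
  have hpointwise (x : E) : -(2 * η x * fderiv ℝ η x e * innerSL ℝ e x) ≤
      1 / 2 * η x ^ 2 + 2 * R ^ 2 * ‖fderiv ℝ η x‖ ^ 2 := by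
    rcases eq_or_ne (η x) 0 with hx | hx
    · rw [hx, mul_zero, zero_mul, zero_mul, neg_zero]
      positivity
    have hD : fderiv ℝ η x e ^ 2 ≤ ‖fderiv ℝ η x‖ ^ 2 :=
      sq_le_sq' (neg_le_of_abs_le (by simpa [he] using (fderiv ℝ η x).le_opNorm e))
        (le_of_abs_le (by simpa [he] using (fderiv ℝ η x).le_opNorm e))
    have hc : innerSL ℝ e x ^ 2 ≤ R ^ 2 := by
      refine sq_le_sq.2 (le_trans ?_ ((hR x hx).trans (le_abs_self R)))
      simpa [he] using abs_real_inner_le_norm e x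
    nlinarith [sq_nonneg (η x + 2 * (fderiv ℝ η x e * innerSL ℝ e x)),
      mul_le_mul hD hc (sq_nonneg _) (sq_nonneg _)]
  have hle := integral_mono (μ := μ)
    (f := fun x => -(2 * η x * fderiv ℝ η x e * innerSL ℝ e x))
    (integrable_of_hasCompactSupport_of_eq_zero hη_supp (by fun_prop) fun x hx => by simp [hx])
    ((hη_int.const_mul _).add (hderiv_int.const_mul _)) hpointwise
  rw [integral_neg, ← integral_sq_eq_neg_integral_fderiv_mul hη hη_supp _ (by simp [he])] at hle
  simp only [Pi.add_apply] at hle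
  rw [integral_add (hη_int.const_mul _) (hderiv_int.const_mul _), integral_const_mul,
    integral_const_mul] at hle
  linarith

end Friedrichs

section L2

variable {α : Type*} [MeasurableSpace α] {μ : Measure α} {F : Type*} [NormedAddCommGroup F]
  [InnerProductSpace ℝ F]

theorem norm_sq_eq_integral (u : Lp F 2 μ) : ‖u‖ ^ 2 = ∫ x, ‖u x‖ ^ 2 ∂μ := by
  rw [← real_inner_self_eq_norm_sq, L2.inner_def]
  simp

theorem integrable_norm_sq (u : Lp F 2 μ) : Integrable (fun x => ‖u x‖ ^ 2) μ := by
  simpa using L2.integrable_inner (𝕜 := ℝ) u u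

end L2

theorem norm_gradient {E : Type*} [NormedAddCommGroup E] [InnerProductSpace ℝ E] [CompleteSpace E]
    (f : E → ℝ) (x : E) : ‖gradient f x‖ = ‖fderiv ℝ f x‖ := by
  simp [gradient]

section Energy

variable {d : ℕ} {Ω : Set (EuclideanSpace ℝ (Fin d))}
  {a : EuclideanSpace ℝ (Fin d) → Matrix (Fin d) (Fin d) ℝ} {lmin lmax : ℝ}

instance : CompleteSpace (H10 Ω) :=
  inferInstanceAs (CompleteSpace (testPairs Ω).topologicalClosure)

theorem grad_add (u v : H10 Ω) : grad (u + v) = grad u + grad v := rfl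

theorem grad_smul (c : ℝ) (u : H10 Ω) : grad (c • u) = c • grad u := rfl

theorem norm_sq_eq_norm_val_sq_add_norm_grad_sq (u : H10 Ω) :
    ‖u‖ ^ 2 = ‖val u‖ ^ 2 + ‖grad u‖ ^ 2 :=
  WithLp.prod_norm_sq_eq_of_L2 (u : L2Pair Ω)

theorem norm_grad_le (u : H10 Ω) : ‖grad u‖ ≤ ‖u‖ :=
  le_of_sq_le_sq (by rw [norm_sq_eq_norm_val_sq_add_norm_grad_sq]; simp) (norm_nonneg u)

theorem H10_induction {P : L2Pair Ω → Prop} (hP : IsClosed {p | P p})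
    (htest : ∀ (p : L2Pair Ω) (η : EuclideanSpace ℝ (Fin d) → ℝ), ContDiff ℝ ∞ η →
      HasCompactSupport η → tsupport η ⊆ Ω → p.fst =ᵐ[volume.restrict Ω] η →
      p.snd =ᵐ[volume.restrict Ω] gradient η → P p) (u : H10 Ω) : P u := by
  refine closure_minimal (s := (testPairs Ω : Set (L2Pair Ω))) ?_ hP u.2
  rintro p ⟨η, hη, hη_supp, hηΩ, hfst, hsnd⟩
  exact htest p η hη hη_supp hηΩ hfst hsnd

theorem exists_norm_val_sq_le [NeZero d] (hΩ : Bornology.IsBounded Ω) :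
    ∃ c > 0, ∀ u : H10 Ω, ‖val u‖ ^ 2 ≤ c * ‖grad u‖ ^ 2 := by
  obtain ⟨R, hR⟩ := hΩ.exists_norm_le
  refine ⟨4 * R ^ 2 + 1, by positivity, fun u => ?_⟩
  refine H10_induction (P := fun p => ‖p.fst‖ ^ 2 ≤ (4 * R ^ 2 + 1) * ‖p.snd‖ ^ 2)
    (isClosed_le (by fun_prop) (by fun_prop)) (fun p η hη hη_supp hηΩ hfst hsnd => ?_) u
  have hη_zero (x) (hx : x ∉ Ω) : η x = 0 := image_eq_zero_of_notMem_tsupport fun h => hx (hηΩ h)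
  have hderiv_zero (x) (hx : x ∉ Ω) : fderiv ℝ η x = 0 :=
    image_eq_zero_of_notMem_tsupport fun h => hx (hηΩ (tsupport_fderiv_subset ℝ h))
  have hval : ‖p.fst‖ ^ 2 = ∫ x, η x ^ 2 := by
    rw [norm_sq_eq_integral, ← setIntegral_eq_integral_of_forall_compl_eq_zero (s := Ω)
      (f := fun x => η x ^ 2) fun x hx => by simp [hη_zero x hx]]
    exact integral_congr_ae (hfst.mono fun x hx => by simp [hx])
  have hgrad : ‖p.snd‖ ^ 2 = ∫ x, ‖fderiv ℝ η x‖ ^ 2 := by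
    rw [norm_sq_eq_integral, ← setIntegral_eq_integral_of_forall_compl_eq_zero (s := Ω)
      (f := fun x => ‖fderiv ℝ η x‖ ^ 2) fun x hx => by simp [hderiv_zero x hx]]
    exact integral_congr_ae (hsnd.mono fun x hx => by simp [hx, norm_gradient])
  have hfriedrichs := integral_sq_le_integral_norm_fderiv_sq (μ := volume) (hη.of_le (by simp))
    hη_supp (R := R) fun x hx => hR x (not_imp_comm.1 (hη_zero x) hx)
  rw [← hval, ← hgrad] at hfriedrichs
  linarith [sq_nonneg ‖p.snd‖]

theorem dotProduct_mulVec_comm {A : Matrix (Fin d) (Fin d) ℝ} (hA : A.IsSymm) (v w : Fin d → ℝ) :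
    v ⬝ᵥ (A *ᵥ w) = w ⬝ᵥ (A *ᵥ v) := by
  rw [Matrix.dotProduct_mulVec, ← Matrix.mulVec_transpose, hA, dotProduct_comm]

theorem sq_dotProduct_mulVec_le {A : Matrix (Fin d) (Fin d) ℝ} (hA : A.IsSymm)
    (hA_nonneg : ∀ l, 0 ≤ l ⬝ᵥ (A *ᵥ l)) (v w : Fin d → ℝ) :
    (v ⬝ᵥ (A *ᵥ w)) ^ 2 ≤ (v ⬝ᵥ (A *ᵥ v)) * (w ⬝ᵥ (A *ᵥ w)) := by
  have hsymm : LinearMap.IsSymm (Matrix.toBilin' A) := ⟨fun v w => by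
    simpa only [Matrix.toBilin'_apply', RingHom.id_apply] using dotProduct_mulVec_comm hA v w⟩
  simpa only [Matrix.toBilin'_apply'] using (Matrix.toBilin' A).apply_sq_le_of_symm
    (fun l => (hA_nonneg l).trans_eq (Matrix.toBilin'_apply' A l l).symm) hsymm v w

theorem dotProduct_ofLp_self (l : EuclideanSpace ℝ (Fin d)) : l.ofLp ⬝ᵥ l.ofLp = ‖l‖ ^ 2 := by
  rw [EuclideanSpace.real_norm_sq_eq]
  simp [dotProduct, sq]

namespace IsElliptic

theorem ae_forall_nonneg (ha : IsElliptic Ω a lmin lmax) :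
    ∀ᵐ x ∂(volume.restrict Ω), ∀ l : Fin d → ℝ, 0 ≤ l ⬝ᵥ (a x *ᵥ l) :=
  ha.lower.mono fun x hx l =>
    (mul_nonneg ha.pos.le (by simpa using dotProduct_star_self_nonneg l)).trans (hx l)

theorem ae_abs_dotProduct_mulVec_le (ha : IsElliptic Ω a lmin lmax) (F G : L2Vec Ω) :
    ∀ᵐ x ∂(volume.restrict Ω),
      |(F x).ofLp ⬝ᵥ (a x *ᵥ (G x).ofLp)| ≤ |lmax| * (‖F x‖ * ‖G x‖) := by
  filter_upwards [ha.symm, ha.ae_forall_nonneg, ha.upper] with x hsymm hnonneg hupper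
  have hF := hupper (F x).ofLp
  have hG := hupper (G x).ofLp
  rw [dotProduct_ofLp_self] at hF hG
  have hsq : ((F x).ofLp ⬝ᵥ (a x *ᵥ (G x).ofLp)) ^ 2 ≤ (lmax * (‖F x‖ * ‖G x‖)) ^ 2 :=
    calc _ ≤ ((F x).ofLp ⬝ᵥ (a x *ᵥ (F x).ofLp)) * ((G x).ofLp ⬝ᵥ (a x *ᵥ (G x).ofLp)) :=
          sq_dotProduct_mulVec_le hsymm hnonneg _ _
      _ ≤ (lmax * ‖F x‖ ^ 2) * (lmax * ‖G x‖ ^ 2) :=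
          mul_le_mul hF hG (hnonneg _) ((hnonneg _).trans hF)
      _ = (lmax * (‖F x‖ * ‖G x‖)) ^ 2 := by ring
  simpa only [abs_mul, abs_norm] using sq_le_sq.1 hsq

theorem integrable_dotProduct_mulVec (ha : IsElliptic Ω a lmin lmax) (F G : L2Vec Ω) :
    Integrable (fun x => (F x).ofLp ⬝ᵥ (a x *ᵥ (G x).ofLp)) (volume.restrict Ω) := by
  have hmeas (F : L2Vec Ω) (i : Fin d) :
      AEStronglyMeasurable (fun x => (F x).ofLp i) (volume.restrict Ω) :=
    (EuclideanSpace.proj (𝕜 := ℝ) i).continuous.comp_aestronglyMeasurable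
      (Lp.aestronglyMeasurable F)
  refine Integrable.mono' (((Lp.memLp F).norm.integrable_mul (Lp.memLp G).norm).const_mul |lmax|)
    ?_ (ha.ae_abs_dotProduct_mulVec_le F G)
  simp only [dotProduct, Matrix.mulVec]
  exact Finset.aestronglyMeasurable_fun_sum _ fun i _ => (hmeas F i).mul
    (Finset.aestronglyMeasurable_fun_sum _ fun j _ => (ha.measurable i j).mul (hmeas G j))

end IsElliptic

theorem energyInner_comm (ha : IsElliptic Ω a lmin lmax) (u v : H10 Ω) :
    energyInner a u v = energyInner a v u :=
  integral_congr_ae (ha.symm.mono fun _ hx => dotProduct_mulVec_comm hx _ _)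

theorem energyInner_add_right (ha : IsElliptic Ω a lmin lmax) (u v w : H10 Ω) :
    energyInner a u (v + w) = energyInner a u v + energyInner a u w := by
  rw [energyInner, energyInner, energyInner, ← integral_add
    (ha.integrable_dotProduct_mulVec _ _) (ha.integrable_dotProduct_mulVec _ _), grad_add]
  refine integral_congr_ae ?_
  filter_upwards [Lp.coeFn_add (grad v) (grad w)] with x hx
  rw [hx, Pi.add_apply, WithLp.ofLp_add, Matrix.mulVec_add, dotProduct_add]

theorem energyInner_smul_right (c : ℝ) (u v : H10 Ω) :
    energyInner a u (c • v) = c * energyInner a u v := by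
  rw [energyInner, energyInner, ← integral_const_mul, grad_smul]
  refine integral_congr_ae ?_
  filter_upwards [Lp.coeFn_smul c (grad v)] with x hx
  rw [hx, Pi.smul_apply, WithLp.ofLp_smul, Matrix.mulVec_smul, dotProduct_smul, smul_eq_mul]

/-- The energy scalar product as a bilinear form. Ellipticity is an argument because it makes the
integrals defining `energyInner` converge, hence additive. -/
def energyForm (ha : IsElliptic Ω a lmin lmax) : LinearMap.BilinForm ℝ (H10 Ω) :=
  LinearMap.mk₂ ℝ (energyInner a)
    (fun u v w => by
      rw [energyInner_comm ha, energyInner_add_right ha, energyInner_comm ha w,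
        energyInner_comm ha w])
    (fun c u v => by
      rw [energyInner_comm ha, energyInner_smul_right, energyInner_comm ha v, smul_eq_mul])
    (energyInner_add_right ha) energyInner_smul_right

theorem energyForm_apply (ha : IsElliptic Ω a lmin lmax) (u v : H10 Ω) :
    energyForm ha u v = energyInner a u v := rfl

theorem isPosSemidef_energyForm (ha : IsElliptic Ω a lmin lmax) : (energyForm ha).IsPosSemidef where
  eq := energyInner_comm ha
  nonneg _ := integral_nonneg_of_ae (ha.ae_forall_nonneg.mono fun _ hx => hx _)

theorem energyForm_self_le (ha : IsElliptic Ω a lmin lmax) (u : H10 Ω) :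
    energyForm ha u u ≤ lmax * ‖grad u‖ ^ 2 := by
  rw [norm_sq_eq_integral, ← integral_const_mul]
  refine integral_mono_ae (ha.integrable_dotProduct_mulVec _ _)
    ((integrable_norm_sq _).const_mul _) (ha.upper.mono fun x hx => ?_)
  simpa [dotProduct_ofLp_self] using hx (grad u x).ofLp

theorem le_energyForm_self (ha : IsElliptic Ω a lmin lmax) (u : H10 Ω) :
    lmin * ‖grad u‖ ^ 2 ≤ energyForm ha u u := by
  rw [norm_sq_eq_integral, ← integral_const_mul]
  refine integral_mono_ae ((integrable_norm_sq _).const_mul _)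
    (ha.integrable_dotProduct_mulVec _ _) (ha.lower.mono fun x hx => ?_)
  simpa [dotProduct_ofLp_self] using hx (grad u x).ofLp

theorem abs_energyForm_le (ha : IsElliptic Ω a lmin lmax) (u v : H10 Ω) :
    |energyForm ha u v| ≤ |lmax| * ‖u‖ * ‖v‖ := by
  have hB := isPosSemidef_energyForm ha
  have hself (u : H10 Ω) : energyForm ha u u ≤ |lmax| * ‖u‖ ^ 2 :=
    (energyForm_self_le ha u).trans (by gcongr; exacts [le_abs_self _, norm_grad_le u])
  refine abs_le_of_sq_le_sq ?_ (by positivity)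
  calc energyForm ha u v ^ 2 ≤ energyForm ha u u * energyForm ha v v :=
        (energyForm ha).apply_sq_le_of_symm hB.nonneg ⟨hB.eq⟩ u v
    _ ≤ (|lmax| * ‖u‖ ^ 2) * (|lmax| * ‖v‖ ^ 2) :=
        mul_le_mul (hself u) (hself v) (hB.nonneg v) (by positivity)
    _ = (|lmax| * ‖u‖ * ‖v‖) ^ 2 := by ring

/-- The energy scalar product as a continuous bilinear form, for use with the Lax–Milgram
theorem. -/
def energyCLM (ha : IsElliptic Ω a lmin lmax) : H10 Ω →L[ℝ] H10 Ω →L[ℝ] ℝ :=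
  (energyForm ha).mkContinuous₂ |lmax| (abs_energyForm_le ha)

theorem isCoercive_energyCLM [NeZero d] (hΩ : Bornology.IsBounded Ω)
    (ha : IsElliptic Ω a lmin lmax) : IsCoercive (energyCLM ha) := by
  obtain ⟨c, hc, hfriedrichs⟩ := exists_norm_val_sq_le hΩ
  have hlmin := ha.pos
  refine ⟨lmin / (c + 1), by positivity, fun u => ?_⟩
  have hnorm : ‖u‖ ^ 2 ≤ (c + 1) * ‖grad u‖ ^ 2 := by
    linarith [norm_sq_eq_norm_val_sq_add_norm_grad_sq u, hfriedrichs u]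
  calc lmin / (c + 1) * ‖u‖ * ‖u‖ = lmin / (c + 1) * ‖u‖ ^ 2 := by ring
    _ ≤ lmin / (c + 1) * ((c + 1) * ‖grad u‖ ^ 2) := by gcongr
    _ = lmin * ‖grad u‖ ^ 2 := by field_simp
    _ ≤ energyForm ha u u := le_energyForm_self ha u

theorem energyForm_self_pos [NeZero d] (hΩ : Bornology.IsBounded Ω)
    (ha : IsElliptic Ω a lmin lmax) {u : H10 Ω} (hu : u ≠ 0) : 0 < energyForm ha u u := by
  obtain ⟨c, hc, hcoercive⟩ := isCoercive_energyCLM hΩ ha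
  have hnorm : 0 < ‖u‖ := norm_pos_iff.2 hu
  exact (mul_pos (mul_pos hc hnorm) hnorm).trans_le (hcoercive u)

end Energy

section Measurement

variable {d : ℕ} {Ω : Set (EuclideanSpace ℝ (Fin d))} {φ : EuclideanSpace ℝ (Fin d) → ℝ}

theorem measurement_eq_inner (hφ : MemLp φ 2 (volume.restrict Ω)) (u : H10 Ω) :
    measurement φ u = inner ℝ (hφ.toLp φ) (val u) := by
  rw [L2.inner_def]
  exact integral_congr_ae (hφ.coeFn_toLp.mono fun x hx => by simp [hx, mul_comm])

/-- The measurement by a square integrable function as a continuous linear functional. -/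
def measurementCLM (hφ : MemLp φ 2 (volume.restrict Ω)) : H10 Ω →L[ℝ] ℝ :=
  innerSL ℝ (hφ.toLp φ) ∘L WithLp.fstL 2 ℝ (L2 Ω) (L2Vec Ω) ∘L (H10 Ω).subtypeL

theorem measurementCLM_apply (hφ : MemLp φ 2 (volume.restrict Ω)) (u : H10 Ω) :
    measurementCLM hφ u = measurement φ u :=
  (measurement_eq_inner hφ u).symm

theorem measurement_le_norm_mul_norm_val (g : L2 Ω) (u : H10 Ω) :
    measurement g u ≤ ‖g‖ * ‖val u‖ := by
  rw [measurement_eq_inner (Lp.memLp g), Lp.toLp_coeFn]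
  exact real_inner_le_norm _ _

theorem existsUnique_isWeakSolution [NeZero d] (hΩ : Bornology.IsBounded Ω)
    {a : EuclideanSpace ℝ (Fin d) → Matrix (Fin d) (Fin d) ℝ} {lmin lmax : ℝ}
    (ha : IsElliptic Ω a lmin lmax) (hφ : MemLp φ 2 (volume.restrict Ω)) :
    ∃! u : H10 Ω, IsWeakSolution a φ u := by
  obtain ⟨u, hu⟩ := exists_form_apply_eq_of_isCoercive (isCoercive_energyCLM hΩ ha)
    (measurementCLM hφ)
  have hu_weak : IsWeakSolution a φ u := fun v =>
    ((isPosSemidef_energyForm ha).eq v u).trans ((hu v).trans (measurementCLM_apply hφ v))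
  refine ⟨u, hu_weak, fun u' hu' => sub_eq_zero.1 (by_contra fun hne => ?_)⟩
  refine (energyForm_self_pos hΩ ha hne).ne' ?_
  rw [LinearMap.BilinForm.sub_right, energyForm_apply, energyForm_apply, hu', hu_weak, sub_self]

end Measurement

/-! ### Convex partitions -/

section Cells

variable {d : ℕ} {Ω : Set (EuclideanSpace ℝ (Fin d))}

theorem exists_val_ae_eq {η : EuclideanSpace ℝ (Fin d) → ℝ} (hη : ContDiff ℝ ∞ η)
    (hη_cpt : HasCompactSupport η) (hηΩ : tsupport η ⊆ Ω) :
    ∃ u : H10 Ω, val u =ᵐ[volume.restrict Ω] η := by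
  have hη_memLp : MemLp η 2 (volume.restrict Ω) :=
    (hη.continuous.memLp_of_hasCompactSupport hη_cpt).restrict _
  have hgrad_cont : Continuous (gradient η) :=
    (InnerProductSpace.toDual ℝ (EuclideanSpace ℝ (Fin d))).symm.continuous.comp
      (hη.continuous_fderiv (by simp))
  have hgrad_cpt : HasCompactSupport (gradient η) :=
    (hη_cpt.fderiv (𝕜 := ℝ)).mono fun x hx h => hx (by rw [gradient, h, map_zero])
  have hgrad_memLp : MemLp (gradient η) 2 (volume.restrict Ω) :=
    (hgrad_cont.memLp_of_hasCompactSupport hgrad_cpt).restrict _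
  have hmem : (WithLp.toLp 2 (hη_memLp.toLp η, hgrad_memLp.toLp (gradient η)) : L2Pair Ω) ∈
      testPairs Ω :=
    ⟨η, hη, hη_cpt, hηΩ, hη_memLp.coeFn_toLp, hgrad_memLp.coeFn_toLp⟩
  exact ⟨⟨_, (testPairs Ω).le_topologicalClosure hmem⟩, hη_memLp.coeFn_toLp⟩

theorem norm_sq_LpToLpRestrictCLM {F : Type*} [NormedAddCommGroup F] [InnerProductSpace ℝ F]
    {K : Set (EuclideanSpace ℝ (Fin d))} (hKΩ : K ⊆ Ω) (u : Lp F 2 (volume.restrict Ω)) :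
    ‖LpToLpRestrictCLM _ F ℝ (volume.restrict Ω) 2 K u‖ ^ 2 = ∫ x in K, ‖u x‖ ^ 2 := by
  have restrict_ae_eq : ∫ x, ‖LpToLpRestrictCLM _ F ℝ (volume.restrict Ω) 2 K u x‖ ^ 2
      ∂((volume.restrict Ω).restrict K) = ∫ x, ‖u x‖ ^ 2 ∂((volume.restrict Ω).restrict K) := by
    refine integral_congr_ae ?_
    filter_upwards [LpToLpRestrictCLM_coeFn (p := 2) ℝ K u] with x hx
    rw [hx]
  rw [norm_sq_eq_integral, restrict_ae_eq, Measure.restrict_restrict_of_subset hKΩ]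

theorem setIntegral_norm_val_sq_le [NeZero d] {K : Set (EuclideanSpace ℝ (Fin d))}
    (hK_open : IsOpen K) (hK : Convex ℝ K) (hK_bdd : Bornology.IsBounded K) {H : ℝ}
    (hKH : ∀ x ∈ K, ∀ y ∈ K, dist x y ≤ H) (hKΩ : K ⊆ Ω) {u : H10 Ω}
    (hu : ∫ x in K, val u x = 0) :
    ∫ x in K, ‖val u x‖ ^ 2 ≤ (2 * H / Real.pi) ^ 2 * ∫ x in K, ‖grad u x‖ ^ 2 := by
  have hK_ne_top : (volume.restrict Ω) K ≠ ⊤ :=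
    ((Measure.restrict_apply_le _ _).trans_lt hK_bdd.measure_lt_top).ne
  let indicatorK : L2 Ω := indicatorConstLp 2 hK_open.measurableSet hK_ne_top 1
  have inner_indicatorK (v : L2 Ω) : inner ℝ indicatorK v = ∫ x in K, v x := by
    rw [L2.inner_indicatorConstLp_one, Measure.restrict_restrict_of_subset hKΩ]
  have poincare := H10_induction (P := fun p =>
    ‖LpToLpRestrictCLM _ ℝ ℝ (volume.restrict Ω) 2 K p.fst‖ ^ 2 ≤
      (2 * H / Real.pi) ^ 2 *
        ‖LpToLpRestrictCLM _ (EuclideanSpace ℝ (Fin d)) ℝ (volume.restrict Ω) 2 K p.snd‖ ^ 2 +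
      (inner ℝ indicatorK p.fst) ^ 2 / volume.real K)
    (isClosed_le (by fun_prop) (by fun_prop)) (fun p η hη _ _ hfst hsnd => ?_) u
  · rw [norm_sq_LpToLpRestrictCLM hKΩ, norm_sq_LpToLpRestrictCLM hKΩ, inner_indicatorK] at poincare
    change ∫ x in K, ‖val u x‖ ^ 2 ≤ (2 * H / Real.pi) ^ 2 * (∫ x in K, ‖grad u x‖ ^ 2) +
      (∫ x in K, val u x) ^ 2 / volume.real K at poincare
    simpa [hu] using poincare
  · have hfst_K := ae_restrict_of_ae_restrict_of_subset hKΩ hfst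
    have hsnd_K := ae_restrict_of_ae_restrict_of_subset hKΩ hsnd
    have integral_fst : ∫ x in K, ‖p.fst x‖ ^ 2 = ∫ x in K, η x ^ 2 := by
      refine integral_congr_ae ?_
      filter_upwards [hfst_K] with x hx
      rw [hx, Real.norm_eq_abs, sq_abs]
    have integral_snd : ∫ x in K, ‖p.snd x‖ ^ 2 = ∫ x in K, ‖fderiv ℝ η x‖ ^ 2 := by
      refine integral_congr_ae ?_
      filter_upwards [hsnd_K] with x hx
      rw [hx, norm_gradient]
    rw [norm_sq_LpToLpRestrictCLM hKΩ, norm_sq_LpToLpRestrictCLM hKΩ, inner_indicatorK,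
      integral_fst, integral_snd, integral_congr_ae hfst_K]
    exact setIntegral_sq_le_add_sq_integral hK_open hK hK_bdd hKH (hη.of_le (by simp))

namespace IsConvexPartition

variable {ι : Type} {τ : ι → Set (EuclideanSpace ℝ (Fin d))} {H : ℝ}

theorem interior_ae_eq (hτ : IsConvexPartition Ω τ H) (i : ι) : interior (τ i) =ᵐ[volume] τ i :=
  interior_ae_eq_of_null_frontier ((hτ.convex i).addHaar_frontier volume)

theorem interior_cell_subset (hτ : IsConvexPartition Ω τ H) (i : ι) : interior (τ i) ⊆ Ω :=
  interior_subset.trans (hτ.subset i)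

theorem interior_nonempty (hτ : IsConvexPartition Ω τ H) (i : ι) : (interior (τ i)).Nonempty :=
  nonempty_of_measure_ne_zero (μ := volume)
    ((measure_congr (hτ.interior_ae_eq i)).trans_ne (hτ.volume_pos i).ne')

theorem interior_aedisjoint (hτ : IsConvexPartition Ω τ H) :
    Pairwise (Function.onFun (AEDisjoint volume) fun i => interior (τ i)) := fun i j hij =>
  measure_mono_null (inter_subset_inter interior_subset interior_subset)
    (hτ.disjoint i j hij)

theorem iUnion_interior_ae_eq [Countable ι] (hτ : IsConvexPartition Ω τ H) :
    ⋃ i, interior (τ i) =ᵐ[volume] Ω :=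
  (Filter.EventuallyEq.countable_iUnion hτ.interior_ae_eq).trans
    ((LE.le.eventuallyLE (iUnion_subset hτ.subset)).antisymm (ae_le_set.2 hτ.cover))

theorem cellIndicator_ae_eq (hτ : IsConvexPartition Ω τ H) (i : ι) :
    cellIndicator τ i =ᵐ[volume] (interior (τ i)).indicator fun _ => (1 : ℝ) :=
  (indicator_ae_eq_of_ae_eq_set (hτ.interior_ae_eq i)).symm

theorem memLp_cellIndicator (hτ : IsConvexPartition Ω τ H) (hΩ : Bornology.IsBounded Ω) (i : ι) :
    MemLp (cellIndicator τ i) 2 (volume.restrict Ω) := by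
  have memLp_interior : MemLp ((interior (τ i)).indicator fun _ => (1 : ℝ)) 2 volume :=
    memLp_indicator_const 2 isOpen_interior.measurableSet 1
      (Or.inr (hΩ.subset (hτ.interior_cell_subset i)).measure_lt_top.ne)
  exact (memLp_interior.ae_eq (hτ.cellIndicator_ae_eq i).symm).restrict _

theorem measurement_eq_setIntegral (hτ : IsConvexPartition Ω τ H) (i : ι) (u : H10 Ω) :
    measurement (cellIndicator τ i) u = ∫ x in interior (τ i), val u x := by
  have mul_eq_indicator : ∫ x in Ω, cellIndicator τ i x * val u x =
      ∫ x in Ω, (interior (τ i)).indicator (val u) x := by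
    refine integral_congr_ae ?_
    filter_upwards [ae_restrict_of_ae (hτ.cellIndicator_ae_eq i)] with x hx
    by_cases hxi : x ∈ interior (τ i) <;> simp [hx, hxi]
  rw [measurement, mul_eq_indicator, setIntegral_indicator isOpen_interior.measurableSet,
    inter_eq_right.2 (hτ.interior_cell_subset i)]

theorem exists_isAdmissible (hτ : IsConvexPartition Ω τ H) (i : ι) :
    ∃ η : H10 Ω, IsAdmissible (cellIndicator τ) i η := by
  obtain ⟨x, hx⟩ := hτ.interior_nonempty i
  obtain ⟨r, hr, hball⟩ :=
    Metric.nhds_basis_closedBall.mem_iff.1 (isOpen_interior.mem_nhds hx)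
  let bump : ContDiffBump x := ⟨r / 2, r, half_pos hr, half_lt_self hr⟩
  have tsupport_subset : tsupport (bump.normed volume) ⊆ interior (τ i) :=
    bump.tsupport_normed_eq.trans_subset hball
  have eq_zero {y} (hy : y ∉ interior (τ i)) : bump.normed volume y = 0 :=
    image_eq_zero_of_notMem_tsupport fun h => hy (tsupport_subset h)
  obtain ⟨η, hη⟩ := exists_val_ae_eq bump.contDiff_normed bump.hasCompactSupport_normed
    (tsupport_subset.trans (hτ.interior_cell_subset i))
  refine ⟨η, fun j => ?_⟩
  rw [hτ.measurement_eq_setIntegral, integral_congr_ae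
    (ae_restrict_of_ae_restrict_of_subset (hτ.interior_cell_subset j) hη)]
  split_ifs with hij
  · subst hij
    rw [setIntegral_eq_integral_of_forall_compl_eq_zero fun y hy => eq_zero hy,
      bump.integral_normed]
  · refine integral_eq_zero_of_ae ?_
    rw [EventuallyEq, ae_restrict_iff' isOpen_interior.measurableSet]
    filter_upwards [measure_eq_zero_iff_ae_notMem.1 (hτ.interior_aedisjoint hij)] with y hy hyj
    exact eq_zero fun hyi => hy ⟨hyi, hyj⟩

theorem setIntegral_eq_sum [Fintype ι] (hτ : IsConvexPartition Ω τ H)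
    {f : EuclideanSpace ℝ (Fin d) → ℝ} (hf : IntegrableOn f Ω) :
    ∫ x in Ω, f x = ∑ i, ∫ x in interior (τ i), f x := by
  rw [← setIntegral_congr_set hτ.iUnion_interior_ae_eq,
    integral_iUnion_ae (fun i => isOpen_interior.measurableSet.nullMeasurableSet)
      hτ.interior_aedisjoint (hf.mono_set (iUnion_subset hτ.interior_cell_subset)), tsum_fintype]

theorem mesh_nonneg (hτ : IsConvexPartition Ω τ H) (i : ι) : 0 ≤ H :=
  Metric.diam_nonneg.trans (hτ.diam_le i)

theorem norm_eq_zero_of_isEmpty [IsEmpty ι] (hτ : IsConvexPartition Ω τ H) {F : Type*}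
    [NormedAddCommGroup F] [InnerProductSpace ℝ F] (w : Lp F 2 (volume.restrict Ω)) :
    ‖w‖ = 0 := by
  have volume_eq_zero : volume Ω = 0 := by simpa using hτ.cover
  rw [← sq_eq_zero_iff, norm_sq_eq_integral, setIntegral_measure_zero _ volume_eq_zero]

theorem mesh_mul_norm_nonneg (hτ : IsConvexPartition Ω τ H) (g : L2 Ω) : 0 ≤ H * ‖g‖ := by
  rcases isEmpty_or_nonempty ι with hι | ⟨⟨i⟩⟩
  · rw [hτ.norm_eq_zero_of_isEmpty, mul_zero]
  · exact mul_nonneg (hτ.mesh_nonneg i) (norm_nonneg g)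

theorem norm_val_le [Finite ι] [NeZero d] (hΩ : Bornology.IsBounded Ω)
    (hτ : IsConvexPartition Ω τ H) {v : H10 Ω}
    (hv : ∀ i, measurement (cellIndicator τ i) v = 0) :
    ‖val v‖ ≤ 2 * H / Real.pi * ‖grad v‖ := by
  have := Fintype.ofFinite ι
  rcases isEmpty_or_nonempty ι with hι | ⟨⟨i₀⟩⟩
  · rw [hτ.norm_eq_zero_of_isEmpty, hτ.norm_eq_zero_of_isEmpty, mul_zero]
  · have hH : 0 ≤ H := hτ.mesh_nonneg i₀
    refine le_of_sq_le_sq ?_ (by positivity)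
    rw [mul_pow, norm_sq_eq_integral, norm_sq_eq_integral,
      hτ.setIntegral_eq_sum (integrable_norm_sq _), hτ.setIntegral_eq_sum (integrable_norm_sq _),
      Finset.mul_sum]
    refine Finset.sum_le_sum fun i _ => ?_
    have hτi_bdd := hΩ.subset (hτ.subset i)
    refine setIntegral_norm_val_sq_le isOpen_interior (hτ.convex i).interior
      (hτi_bdd.subset interior_subset) (fun x hx y hy => ?_) (hτ.interior_cell_subset i) ?_
    · exact (Metric.dist_le_diam_of_mem hτi_bdd (interior_subset hx)
        (interior_subset hy)).trans (hτ.diam_le i)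
    · rw [← hτ.measurement_eq_setIntegral, hv]

end IsConvexPartition

end Cells

/-! ### Gamblets -/

section Gamblets

variable {d : ℕ} {Ω : Set (EuclideanSpace ℝ (Fin d))}
  {a : EuclideanSpace ℝ (Fin d) → Matrix (Fin d) (Fin d) ℝ} {lmin lmax : ℝ} {ι : Type}
  {φ : ι → EuclideanSpace ℝ (Fin d) → ℝ} {ψ : ι → H10 Ω}

theorem energyNorm_sq (ha : IsElliptic Ω a lmin lmax) (u : H10 Ω) :
    energyNorm a u ^ 2 = energyForm ha u u :=
  Real.sq_sqrt ((isPosSemidef_energyForm ha).nonneg u)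

theorem norm_grad_mul_sqrt_le_energyNorm (ha : IsElliptic Ω a lmin lmax) (u : H10 Ω) :
    ‖grad u‖ * √lmin ≤ energyNorm a u := by
  refine le_of_sq_le_sq ?_ (Real.sqrt_nonneg _)
  rw [mul_pow, Real.sq_sqrt ha.pos.le, energyNorm_sq ha, mul_comm]
  exact le_energyForm_self ha u

theorem energyForm_eq_zero_of_mem_solutionSpan (ha : IsElliptic Ω a lmin lmax) {u v : H10 Ω}
    (hu : ∀ i, measurement (φ i) u = 0) (hv : v ∈ solutionSpan Ω a φ) :
    energyForm ha u v = 0 := by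
  have span_le_ker : solutionSpan Ω a φ ≤ LinearMap.ker (energyForm ha u) := by
    refine Submodule.span_le.2 ?_
    rintro w ⟨i, hw⟩
    exact (hw u).trans (hu i)
  exact span_le_ker hv

theorem measurement_sub {f : EuclideanSpace ℝ (Fin d) → ℝ} (hf : MemLp f 2 (volume.restrict Ω))
    (u v : H10 Ω) : measurement f (u - v) = measurement f u - measurement f v := by
  simp only [← measurementCLM_apply hf, map_sub]

theorem IsAdmissible.energyForm_self_eq (ha : IsElliptic Ω a lmin lmax)
    (hφ : ∀ i, MemLp (φ i) 2 (volume.restrict Ω)) {i : ι} {η χ : H10 Ω}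
    (hη : IsAdmissible φ i η) (hχ : IsAdmissible φ i χ) (hχ_mem : χ ∈ solutionSpan Ω a φ) :
    energyForm ha η η = energyForm ha (η - χ) (η - χ) + energyForm ha χ χ := by
  have hsub (j : ι) : measurement (φ j) (η - χ) = 0 := by
    rw [measurement_sub (hφ j), hη j, hχ j, sub_self]
  rw [← form_add_self (isPosSemidef_energyForm ha).isSymm
    (energyForm_eq_zero_of_mem_solutionSpan ha hsub hχ_mem), sub_add_cancel]

theorem exists_solutionSpan_eq_span_range [NeZero d] (hΩ : Bornology.IsBounded Ω)
    (ha : IsElliptic Ω a lmin lmax) (hφ : ∀ i, MemLp (φ i) 2 (volume.restrict Ω)) :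
    ∃ w : ι → H10 Ω, (∀ i, IsWeakSolution a (φ i) (w i)) ∧
      solutionSpan Ω a φ = Submodule.span ℝ (range w) := by
  choose w hw hw_unique using fun i => existsUnique_isWeakSolution hΩ ha (hφ i)
  refine ⟨w, hw, congrArg (Submodule.span ℝ) (Subset.antisymm ?_ ?_)⟩
  · rintro v ⟨i, hv⟩
    exact ⟨i, (hw_unique i v hv).symm⟩
  · rintro _ ⟨i, rfl⟩
    exact ⟨i, hw i⟩

theorem exists_isAdmissible_span_eq [NeZero d] [Finite ι] (hΩ : Bornology.IsBounded Ω)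
    (ha : IsElliptic Ω a lmin lmax) (hφ : ∀ i, MemLp (φ i) 2 (volume.restrict Ω))
    (hφ_adm : ∀ i, ∃ η : H10 Ω, IsAdmissible φ i η) :
    ∃ ψ : ι → H10 Ω, (∀ i, IsAdmissible φ i (ψ i)) ∧
      Submodule.span ℝ (range ψ) = solutionSpan Ω a φ := by
  classical
  obtain ⟨w, hw, hspan⟩ := exists_solutionSpan_eq_span_range hΩ ha hφ
  choose η hη using hφ_adm
  have hw_indep : LinearIndependent ℝ w :=
    linearIndependent_of_exists_dual (B := energyForm ha) fun i j =>
      (hw j (η i)).trans ((hη i j).trans (by congr))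
  obtain ⟨ψ, hψ_span, hψ⟩ :=
    exists_dual_span_eq (B := energyForm ha) (fun _ => energyForm_self_pos hΩ ha) hw_indep
  exact ⟨ψ, fun i j => (hw j (ψ i)).symm.trans ((hψ i j).trans (by congr)),
    hψ_span.trans hspan.symm⟩

theorem isGamblets_iff_eq [NeZero d] (hΩ : Bornology.IsBounded Ω)
    (ha : IsElliptic Ω a lmin lmax) (hφ : ∀ i, MemLp (φ i) 2 (volume.restrict Ω))
    {ψ₀ : ι → H10 Ω} (hψ₀ : ∀ i, IsAdmissible φ i (ψ₀ i))
    (hψ₀_mem : ∀ i, ψ₀ i ∈ solutionSpan Ω a φ) : IsGamblets a φ ψ ↔ ψ = ψ₀ := by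
  have hpos := isPosSemidef_energyForm ha
  constructor
  · refine fun hψ => funext fun i => sub_eq_zero.1 (by_contra fun hne => ?_)
    have hle : energyForm ha (ψ i) (ψ i) ≤ energyForm ha (ψ₀ i) (ψ₀ i) :=
      (Real.sqrt_le_sqrt_iff (hpos.nonneg _)).1 ((hψ i).2 _ (hψ₀ i))
    rw [(hψ i).1.energyForm_self_eq ha hφ (hψ₀ i) (hψ₀_mem i)] at hle
    linarith [energyForm_self_pos hΩ ha hne]
  · rintro rfl i
    refine ⟨hψ₀ i, fun η hη => Real.sqrt_le_sqrt ?_⟩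
    rw [← energyForm_apply ha η η, hη.energyForm_self_eq ha hφ (hψ₀ i) (hψ₀_mem i)]
    exact le_add_of_nonneg_left (hpos.nonneg _)

theorem existsUnique_isGamblets [NeZero d] [Finite ι] (hΩ : Bornology.IsBounded Ω)
    (ha : IsElliptic Ω a lmin lmax) (hφ : ∀ i, MemLp (φ i) 2 (volume.restrict Ω))
    (hφ_adm : ∀ i, ∃ η : H10 Ω, IsAdmissible φ i η) :
    ∃! ψ : ι → H10 Ω, IsGamblets a φ ψ := by
  obtain ⟨ψ₀, hψ₀, hspan⟩ := exists_isAdmissible_span_eq hΩ ha hφ hφ_adm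
  have hiff (ψ : ι → H10 Ω) : IsGamblets a φ ψ ↔ ψ = ψ₀ :=
    isGamblets_iff_eq hΩ ha hφ hψ₀ fun i => hspan ▸ Submodule.subset_span (mem_range_self i)
  exact ⟨ψ₀, (hiff ψ₀).2 rfl, fun ψ hψ => (hiff ψ).1 hψ⟩

theorem IsGamblets.span_range_eq [NeZero d] [Finite ι] (hΩ : Bornology.IsBounded Ω)
    (ha : IsElliptic Ω a lmin lmax) (hφ : ∀ i, MemLp (φ i) 2 (volume.restrict Ω))
    (hψ : IsGamblets a φ ψ) : Submodule.span ℝ (range ψ) = solutionSpan Ω a φ := by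
  obtain ⟨ψ₀, hψ₀, hspan⟩ := exists_isAdmissible_span_eq hΩ ha hφ fun i => ⟨ψ i, (hψ i).1⟩
  obtain rfl : ψ = ψ₀ := (isGamblets_iff_eq hΩ ha hφ hψ₀ fun i =>
    hspan ▸ Submodule.subset_span (mem_range_self i)).1 hψ
  exact hspan

variable [Fintype ι]

theorem recovery_mem_span (φ : ι → EuclideanSpace ℝ (Fin d) → ℝ) (ψ : ι → H10 Ω) (u : H10 Ω) :
    recovery φ ψ u ∈ Submodule.span ℝ (range ψ) :=
  Submodule.sum_mem _ fun i _ =>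
    Submodule.smul_mem _ _ (Submodule.subset_span (mem_range_self i))

theorem measurement_sub_recovery (hφ : ∀ i, MemLp (φ i) 2 (volume.restrict Ω))
    (hψ : ∀ i, IsAdmissible φ i (ψ i)) (u : H10 Ω) (j : ι) :
    measurement (φ j) (u - recovery φ ψ u) = 0 := by
  classical
  rw [measurement_sub (hφ j), ← measurementCLM_apply (hφ j) (recovery φ ψ u), recovery, map_sum]
  simp only [map_smul, measurementCLM_apply, hψ _ j, smul_eq_mul, mul_ite, mul_one, mul_zero]
  rw [Finset.sum_ite_eq', if_pos (Finset.mem_univ j), sub_self]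

namespace IsGamblets

variable [NeZero d]

theorem energyForm_sub_recovery_eq_zero (hΩ : Bornology.IsBounded Ω)
    (ha : IsElliptic Ω a lmin lmax) (hφ : ∀ i, MemLp (φ i) 2 (volume.restrict Ω))
    (hψ : IsGamblets a φ ψ) (u : H10 Ω) {v : H10 Ω} (hv : v ∈ Submodule.span ℝ (range ψ)) :
    energyForm ha (u - recovery φ ψ u) v = 0 :=
  energyForm_eq_zero_of_mem_solutionSpan ha
    (measurement_sub_recovery hφ (fun i => (hψ i).1) u) (hψ.span_range_eq hΩ ha hφ ▸ hv)

theorem energyNorm_sub_recovery_eq_iInf (hΩ : Bornology.IsBounded Ω)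
    (ha : IsElliptic Ω a lmin lmax) (hφ : ∀ i, MemLp (φ i) 2 (volume.restrict Ω))
    (hψ : IsGamblets a φ ψ) (u : H10 Ω) :
    energyNorm a (u - recovery φ ψ u) =
      ⨅ v : Submodule.span ℝ (range ψ), energyNorm a (u - (v : H10 Ω)) :=
  sqrt_form_sub_eq_iInf (isPosSemidef_energyForm ha) (recovery_mem_span φ ψ u)
    fun _ => hψ.energyForm_sub_recovery_eq_zero hΩ ha hφ u

theorem energyForm_sub_recovery_self (hΩ : Bornology.IsBounded Ω)
    (ha : IsElliptic Ω a lmin lmax) (hφ : ∀ i, MemLp (φ i) 2 (volume.restrict Ω))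
    (hψ : IsGamblets a φ ψ) {g : EuclideanSpace ℝ (Fin d) → ℝ} {u : H10 Ω}
    (hu : IsWeakSolution a g u) :
    energyForm ha (u - recovery φ ψ u) (u - recovery φ ψ u) =
      measurement g (u - recovery φ ψ u) := by
  rw [LinearMap.BilinForm.sub_right,
    hψ.energyForm_sub_recovery_eq_zero hΩ ha hφ u (recovery_mem_span φ ψ u), sub_zero]
  exact hu _

end IsGamblets

theorem IsConvexPartition.energyNorm_sub_recovery_le [NeZero d]
    {τ : ι → Set (EuclideanSpace ℝ (Fin d))} {H : ℝ} (hΩ : Bornology.IsBounded Ω)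
    (ha : IsElliptic Ω a lmin lmax) (hτ : IsConvexPartition Ω τ H)
    (hψ : IsGamblets a (cellIndicator τ) ψ) {g : L2 Ω} {u : H10 Ω} (hu : IsWeakSolution a g u) :
    energyNorm a (u - recovery (cellIndicator τ) ψ u) ≤ 2 / (Real.pi * √lmin) * H * ‖g‖ := by
  have hφ := hτ.memLp_cellIndicator hΩ
  set v := u - recovery (cellIndicator τ) ψ u with hv
  have energyNorm_sq_le : energyNorm a v ^ 2 ≤
      2 / (Real.pi * √lmin) * (H * ‖g‖) * energyNorm a v := by
    have hsqrt : 0 < √lmin := Real.sqrt_pos.2 ha.pos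
    have hmesh := hτ.mesh_mul_norm_nonneg g
    calc energyNorm a v ^ 2 = measurement g v := by
          rw [energyNorm_sq ha, hv, hψ.energyForm_sub_recovery_self hΩ ha hφ hu]
      _ ≤ ‖g‖ * ‖val v‖ := measurement_le_norm_mul_norm_val g v
      _ ≤ ‖g‖ * (2 * H / Real.pi * ‖grad v‖) := by
          gcongr
          exact hτ.norm_val_le hΩ (measurement_sub_recovery hφ (fun i => (hψ i).1) u)
      _ = 2 / (Real.pi * √lmin) * (H * ‖g‖) * (‖grad v‖ * √lmin) := by field_simp
      _ ≤ 2 / (Real.pi * √lmin) * (H * ‖g‖) * energyNorm a v := by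
          gcongr
          exact norm_grad_mul_sqrt_le_energyNorm ha v
  rw [mul_assoc _ H]
  have energyNorm_nonneg : 0 ≤ energyNorm a v := Real.sqrt_nonneg _
  rcases energyNorm_nonneg.eq_or_lt with hzero | hpos
  · rw [← hzero]
    exact mul_nonneg (by positivity) (hτ.mesh_mul_norm_nonneg g)
  · rw [sq] at energyNorm_sq_le
    exact le_of_mul_le_mul_right energyNorm_sq_le hpos

end Gamblets

/-! ### Nested partitions -/

section Nested

variable {d : ℕ} {Ω : Set (EuclideanSpace ℝ (Fin d))}
  {a : EuclideanSpace ℝ (Fin d) → Matrix (Fin d) (Fin d) ℝ} {lmin lmax : ℝ}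

theorem integrableOn_val (hΩ : Bornology.IsBounded Ω) (u : H10 Ω) : IntegrableOn (val u) Ω := by
  have : IsFiniteMeasure (volume.restrict Ω) := isFiniteMeasure_restrict.2 hΩ.measure_lt_top.ne
  exact (Lp.memLp (val u)).integrable one_le_two

theorem mem_solutionSpan_of_measurement_eq_sum [NeZero d] (hΩ : Bornology.IsBounded Ω)
    (ha : IsElliptic Ω a lmin lmax) {f : EuclideanSpace ℝ (Fin d) → ℝ}
    (hf : MemLp f 2 (volume.restrict Ω)) {κ : Type} {φ : κ → EuclideanSpace ℝ (Fin d) → ℝ}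
    (hφ : ∀ j, MemLp (φ j) 2 (volume.restrict Ω)) {s : Finset κ}
    (hfφ : ∀ u : H10 Ω, measurement f u = ∑ j ∈ s, measurement (φ j) u) {v : H10 Ω}
    (hv : IsWeakSolution a f v) : v ∈ solutionSpan Ω a φ := by
  choose w hw using fun j => (existsUnique_isWeakSolution hΩ ha (hφ j)).exists
  have hsum : IsWeakSolution a f (∑ j ∈ s, w j) := fun u =>
    calc energyForm ha u (∑ j ∈ s, w j) = ∑ j ∈ s, measurement (φ j) u := by
          rw [map_sum]
          exact Finset.sum_congr rfl fun j _ => hw j u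
      _ = measurement f u := (hfφ u).symm
  rw [(existsUnique_isWeakSolution hΩ ha hf).unique hv hsum]
  exact Submodule.sum_mem _ fun j _ => Submodule.subset_span ⟨j, hw j⟩

namespace IsConvexPartition

variable {ι κ : Type} {τ : ι → Set (EuclideanSpace ℝ (Fin d))}
  {σ : κ → Set (EuclideanSpace ℝ (Fin d))} {H H' : ℝ}

theorem measurement_eq_sum (hΩ : Bornology.IsBounded Ω) (hτ : IsConvexPartition Ω τ H)
    (hσ : IsConvexPartition Ω σ H') {i : ι} {s : Finset κ}
    (hi : τ i =ᵐ[volume] ⋃ j ∈ s, σ j) (u : H10 Ω) :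
    measurement (cellIndicator τ i) u = ∑ j ∈ s, measurement (cellIndicator σ j) u := by
  have hi' : interior (τ i) =ᵐ[volume] ⋃ j : s, interior (σ j) := by
    have hcells : ⋃ j ∈ s, σ j = ⋃ j : s, σ j := (iUnion_subtype (· ∈ s) fun j => σ j).symm
    exact ((hτ.interior_ae_eq i).trans (hi.trans (.of_eq hcells))).trans
      (Filter.EventuallyEq.countable_iUnion fun j : s => hσ.interior_ae_eq j).symm
  have hsub : ⋃ j : s, interior (σ j) ⊆ Ω := iUnion_subset fun j => hσ.interior_cell_subset j
  simp only [hτ.measurement_eq_setIntegral, hσ.measurement_eq_setIntegral]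
  rw [setIntegral_congr_set hi',
    integral_iUnion_ae (s := fun j : s => interior (σ j))
      (fun j => isOpen_interior.measurableSet.nullMeasurableSet)
      (fun j k hjk => hσ.interior_aedisjoint (Subtype.coe_injective.ne hjk))
      ((integrableOn_val hΩ u).mono_set hsub), tsum_fintype]
  exact Finset.sum_coe_sort s fun j => ∫ x in interior (σ j), val u x

theorem solutionSpan_le [NeZero d] (hΩ : Bornology.IsBounded Ω) (ha : IsElliptic Ω a lmin lmax)
    (hτ : IsConvexPartition Ω τ H) (hσ : IsConvexPartition Ω σ H') {s : ι → Finset κ}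
    (hs : ∀ i, τ i =ᵐ[volume] ⋃ j ∈ s i, σ j) :
    solutionSpan Ω a (cellIndicator τ) ≤ solutionSpan Ω a (cellIndicator σ) := by
  refine Submodule.span_le.2 ?_
  rintro v ⟨i, hv⟩
  exact mem_solutionSpan_of_measurement_eq_sum hΩ ha (hτ.memLp_cellIndicator hΩ i)
    (hσ.memLp_cellIndicator hΩ) (hτ.measurement_eq_sum hΩ hσ (hs i)) hv

end IsConvexPartition

section GambletSpace

variable {q : ℕ} {I : Finset (List ℕ)} {ψ : (k : ℕ) → level I k → H10 Ω}

theorem gambletSpace_of_le {k : ℕ} (hk : k ≤ q) :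
    gambletSpace q ψ k = Submodule.span ℝ (range (ψ k)) :=
  if_pos hk

namespace IsNestedPartition

variable {τ : (k : ℕ) → level I k → Set (EuclideanSpace ℝ (Fin d))} {H : ℕ → ℝ} [NeZero d]

theorem gambletSpace_eq_solutionSpan (hΩ : Bornology.IsBounded Ω)
    (ha : IsElliptic Ω a lmin lmax) (hτ : IsNestedPartition Ω q I τ H)
    {k : ℕ} (hk : 1 ≤ k) (hkq : k ≤ q) (hψ : IsGamblets a (cellIndicator (τ k)) (ψ k)) :
    gambletSpace q ψ k = solutionSpan Ω a (cellIndicator (τ k)) := by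
  rw [gambletSpace_of_le hkq,
    hψ.span_range_eq hΩ ha ((hτ.partition k hk hkq).memLp_cellIndicator hΩ)]

theorem gambletSpace_le_succ (hΩ : Bornology.IsBounded Ω) (ha : IsElliptic Ω a lmin lmax)
    (hτ : IsNestedPartition Ω q I τ H)
    (hψ : ∀ k, 1 ≤ k → k ≤ q → IsGamblets a (cellIndicator (τ k)) (ψ k))
    {k : ℕ} (hk : 1 ≤ k) (hkq : k ≤ q) : gambletSpace q ψ k ≤ gambletSpace q ψ (k + 1) := by
  rcases hkq.eq_or_lt with rfl | hlt
  · exact le_top.trans_eq (if_neg (Nat.not_succ_le_self k)).symm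
  · have hk' : 1 ≤ k + 1 := hk.trans k.le_succ
    rw [hτ.gambletSpace_eq_solutionSpan hΩ ha hk hkq (hψ k hk hkq),
      hτ.gambletSpace_eq_solutionSpan hΩ ha hk' hlt (hψ (k + 1) hk' hlt)]
    refine (hτ.partition k hk hkq).solutionSpan_le hΩ ha (hτ.partition (k + 1) hk' hlt)
      (s := fun i => {j | j.val ∈ children I k i}) fun i => ?_
    simpa only [Finset.mem_filter_univ] using hτ.nested k hk hlt i

end IsNestedPartition

end GambletSpace

end Nested

end Gamblet

end

open Gamblet in
theorem mainTheorem3_general {d : ℕ} [NeZero d] {Ω : Set (EuclideanSpace ℝ (Fin d))}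
    (hΩ : Bornology.IsBounded Ω) {a : EuclideanSpace ℝ (Fin d) → Matrix (Fin d) (Fin d) ℝ}
    {lmin lmax : ℝ} (ha : IsElliptic Ω a lmin lmax) :
    (∀ g : L2 Ω, ∃! u : H10 Ω, IsWeakSolution a g u) ∧
    (∀ (ι : Type) [Fintype ι] (τ : ι → Set (EuclideanSpace ℝ (Fin d))) (H : ℝ),
      IsConvexPartition Ω τ H →
      (∃! ψ : ι → H10 Ω, IsGamblets a (cellIndicator τ) ψ) ∧
      ∀ ψ : ι → H10 Ω, IsGamblets a (cellIndicator τ) ψ →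
        ∀ (g : L2 Ω) (u : H10 Ω), IsWeakSolution a g u →
          (⨅ v : Submodule.span ℝ (Set.range ψ), energyNorm a (u - (v : H10 Ω))) ≤
            2 / (Real.pi * Real.sqrt lmin) * H * ‖g‖ ∧
          recovery (cellIndicator τ) ψ u ∈ Submodule.span ℝ (Set.range ψ) ∧
          energyNorm a (u - recovery (cellIndicator τ) ψ u) =
            ⨅ v : Submodule.span ℝ (Set.range ψ), energyNorm a (u - (v : H10 Ω))) ∧
    (∀ (q : ℕ) (I : Finset (List ℕ))
      (τ : (k : ℕ) → level I k → Set (EuclideanSpace ℝ (Fin d))) (H : ℕ → ℝ),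
      IsNestedPartition Ω q I τ H →
      ∀ ψ : (k : ℕ) → level I k → H10 Ω,
        (∀ k, 1 ≤ k → k ≤ q → IsGamblets a (cellIndicator (τ k)) (ψ k)) →
        ∀ k, 1 ≤ k → k ≤ q →
          gambletSpace q ψ k ≤ gambletSpace q ψ (k + 1) ∧
          gambletSpace q ψ k = solutionSpan Ω a (cellIndicator (τ k)) ∧
          ∀ (g : L2 Ω) (u : H10 Ω), IsWeakSolution a g u →
            recovery (cellIndicator (τ k)) (ψ k) u ∈ gambletSpace q ψ k ∧
            energyNorm a (u - recovery (cellIndicator (τ k)) (ψ k) u) =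
              (⨅ v : gambletSpace q ψ k, energyNorm a (u - (v : H10 Ω))) ∧
            (⨅ v : gambletSpace q ψ k, energyNorm a (u - (v : H10 Ω))) ≤
              2 / (Real.pi * Real.sqrt lmin) * H k * ‖g‖) := by
  refine ⟨fun g => existsUnique_isWeakSolution hΩ ha (Lp.memLp g), ?_, ?_⟩
  · intro ι _ τ H hτ
    have hφ := hτ.memLp_cellIndicator hΩ
    refine ⟨existsUnique_isGamblets hΩ ha hφ hτ.exists_isAdmissible, fun ψ hψ g u hu => ?_⟩
    have hbest := hψ.energyNorm_sub_recovery_eq_iInf hΩ ha hφ u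
    exact ⟨hbest ▸ hτ.energyNorm_sub_recovery_le hΩ ha hψ hu, recovery_mem_span _ ψ u, hbest⟩
  · intro q I τ H hτ ψ hψ k hk hkq
    have hτk := hτ.partition k hk hkq
    refine ⟨hτ.gambletSpace_le_succ hΩ ha hψ hk hkq,
      hτ.gambletSpace_eq_solutionSpan hΩ ha hk hkq (hψ k hk hkq), fun g u hu => ?_⟩
    rw [gambletSpace_of_le hkq]
    have hbest := (hψ k hk hkq).energyNorm_sub_recovery_eq_iInf hΩ ha
      (hτk.memLp_cellIndicator hΩ) u
    exact ⟨recovery_mem_span _ _ u, hbest,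
      hbest ▸ hτk.energyNorm_sub_recovery_le hΩ ha (hψ k hk hkq) hu⟩

theorem mainTheorem3 {d : ℕ} (hd : 0 < d) (Ω : Set (EuclideanSpace ℝ (Fin d)))
    (hΩ : IsOpen Ω) (hΩb : Bornology.IsBounded Ω)
    (a : EuclideanSpace ℝ (Fin d) → Matrix (Fin d) (Fin d) ℝ) (lmin lmax : ℝ)
    (ha : Gamblet.IsElliptic Ω a lmin lmax) :
    -- the boundary value problem has exactly one weak solution
    (∀ g : Gamblet.L2 Ω, ∃! u : Gamblet.H10 Ω, Gamblet.IsWeakSolution a g u) ∧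
    -- one level
    (∀ (ι : Type) [Fintype ι] (τ : ι → Set (EuclideanSpace ℝ (Fin d))) (H : ℝ),
      Gamblet.IsConvexPartition Ω τ H →
      (∃! ψ : ι → Gamblet.H10 Ω, Gamblet.IsGamblets a (Gamblet.cellIndicator τ) ψ) ∧
      ∀ ψ : ι → Gamblet.H10 Ω, Gamblet.IsGamblets a (Gamblet.cellIndicator τ) ψ →
        ∀ (g : Gamblet.L2 Ω) (u : Gamblet.H10 Ω), Gamblet.IsWeakSolution a g u →
          (⨅ v : Submodule.span ℝ (Set.range ψ), Gamblet.energyNorm a (u - (v : Gamblet.H10 Ω))) ≤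
            2 / (Real.pi * Real.sqrt lmin) * H * ‖g‖ ∧
          Gamblet.recovery (Gamblet.cellIndicator τ) ψ u ∈ Submodule.span ℝ (Set.range ψ) ∧
          Gamblet.energyNorm a (u - Gamblet.recovery (Gamblet.cellIndicator τ) ψ u) =
            ⨅ v : Submodule.span ℝ (Set.range ψ), Gamblet.energyNorm a (u - (v : Gamblet.H10 Ω))) ∧
    -- several levels
    (∀ (q : ℕ) (I : Finset (List ℕ))
      (τ : (k : ℕ) → Gamblet.level I k → Set (EuclideanSpace ℝ (Fin d))) (H : ℕ → ℝ),
      Gamblet.IsNestedPartition Ω q I τ H →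
      ∀ ψ : (k : ℕ) → Gamblet.level I k → Gamblet.H10 Ω,
        (∀ k, 1 ≤ k → k ≤ q → Gamblet.IsGamblets a (Gamblet.cellIndicator (τ k)) (ψ k)) →
        ∀ k, 1 ≤ k → k ≤ q →
          Gamblet.gambletSpace q ψ k ≤ Gamblet.gambletSpace q ψ (k + 1) ∧
          Gamblet.gambletSpace q ψ k =
            Gamblet.solutionSpan Ω a (Gamblet.cellIndicator (τ k)) ∧
          ∀ (g : Gamblet.L2 Ω) (u : Gamblet.H10 Ω), Gamblet.IsWeakSolution a g u →
            Gamblet.recovery (Gamblet.cellIndicator (τ k)) (ψ k) u ∈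
              Gamblet.gambletSpace q ψ k ∧
            Gamblet.energyNorm a
                (u - Gamblet.recovery (Gamblet.cellIndicator (τ k)) (ψ k) u) =
              (⨅ v : Gamblet.gambletSpace q ψ k, Gamblet.energyNorm a (u - (v : Gamblet.H10 Ω))) ∧
            (⨅ v : Gamblet.gambletSpace q ψ k, Gamblet.energyNorm a (u - (v : Gamblet.H10 Ω))) ≤
              2 / (Real.pi * Real.sqrt lmin) * H k * ‖g‖) := by
  have : NeZero d := ⟨hd.ne'⟩
  exact mainTheorem3_general hΩb ha
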